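/- Let $a,b,c,\sigma$ be measurable functions on $[0,\infty)$ with values in $M_{d_1}(\mathbb R)$, $M_{d_1,m_1}(\mathbb R)$, $M_{d_2,d_1}(\mathbb R)$ and $M_{d_2,m_2}(\mathbb R)$, such that for every $t\ge 0$ $$\int_0^t |a(s)|\,ds<\infty,\quad \int_0^t |b(s)|^2ds<\infty,\quad \int_0^t |c(s)|^2ds<\infty,\quad \int_0^t |\sigma(s)|^2ds<\infty ,$$ and such that for some constant $C>0$ one has $\lambda_{\min}(\sigma(t)\sigma(t)^\top)>C$ for all $t\ge 0$. Put $G(r)=c(r)^\top(\sigma(r)\sigma(r)^\top)^{-1}c(r)$. Let $X_0$ be a normally distributed $\mathbb R^{d_1}$-valued random variable with covariance matrix $V[X_0]$. Let $\gamma$ be the positive semidefinite symmetric solution on $[0,\infty)$ of $$\gamma'(s)=-\gamma(s)G(s)\gamma(s)+a(s)\gamma(s)+\gamma(s)a(s)^\top+b(s)b(s)^\top,\qquad \gamma(0)=V[X_0].$$ Fix $t\ge 0$, and let $\phi(\cdot\,;t)$ be the negative semidefinite symmetric solution on $[0,t]$ of $$\frac{d\phi}{ds}(s;t)=-\phi(s;t)b(s)b(s)^\top\phi(s;t)-a(s)^\top\phi(s;t)-\phi(s;t)a(s)+G(s),\qquad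 \phi(t;t)=0$$ (both equations being understood in integrated form, for continuous functions). Let $\tilde V$ be an $m_1$-dimensional Brownian motion, and let $(\xi_{s;t})_{0\le s\le t}$ be the continuous solution of $$d_s\xi_{s;t}=\{a(s)+b(s)b(s)^\top\phi(s;t)\}\,\xi_{s;t}\,ds+b(s)\,d\tilde V_s ,$$ where $\xi_{0;t}$ is a Gaussian vector independent of $\tilde V$ with mean $0$ and covariance matrix $$V[\xi_{0;t}]=V[X_0]^{1/2}\bigl(I-V[X_0]^{1/2}\phi(0;t)V[X_0]^{1/2}\bigr)^{-1}V[X_0]^{1/2}.$$ For $0\le u\le s$ let $\Psi(s,u)=\exp\left(\int_u^s\{a(r)-\gamma(r)G(r)\}\,dr\right)$ denote the time-ordered exponential, that is, the filter transition matrix, the solution of $$\frac{\partial}{\partial s}\Psi(s,u)=\{a(s)-\gamma(s)G(s)\}\Psi(s,u),\qquad \Psi(u,u)=I$$ (it is given by the Peano–Baker series of iterated integrals). Its transpose $\Psi(s,u)^\top$ is what is denoted by $\exp\left(\int_u^s\{a(r)^\top-G(r)\gamma(r)\}\,dr\right)$. Then $\xi_{s;t}$ is square integrable for every $s\in[0,t]$,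 and for all $0\le u\le s\le t$ $$\mathrm{Cov}(\xi_{s;t},\xi_{u;t})=\Psi(s,u)\,\gamma(u)-\gamma(s)\left(\int_s^t \Psi(v,s)^\top\, c(v)^\top(\sigma(v)\sigma(v)^\top)^{-1}c(v)\,\Psi(v,u)\,dv\right)\gamma(u),$$ where the integral on the right converges absolutely. -/

import Mathlib

open MeasureTheory ProbabilityTheory Filter Topology Set Matrix
open scoped NNReal ENNReal MatrixOrder

/-! Time-dependent coefficients are functions on `ℝ` of which only the values on `[0, ∞)` matter;
Brownian motions are indexed by `ℝ≥0`. Integrals and integrability of matrix functions are taken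
entry by entry, which is the same as integrability with respect to the Frobenius norm. -/

namespace LinearSmoothing

noncomputable section

/-! ### Matrix integrals and time-ordered exponentials -/

/-- The integral `∫_u^s F(r) dr` of a matrix function, entry by entry. -/
def matIntegral {d e : ℕ} (F : ℝ → Matrix (Fin d) (Fin e) ℝ) (u s : ℝ) :
    Matrix (Fin d) (Fin e) ℝ :=
  Matrix.of fun i j => ∫ r in u..s, F r i j

/-- The iterated integrals
`∫_u^s A(r₁) ∫_u^{r₁} A(r₂) ⋯ ∫_u^{rₙ₋₁} A(rₙ) drₙ ⋯ dr₁` of a matrix function `A`. -/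
def iteratedIntegral {d : ℕ} (A : ℝ → Matrix (Fin d) (Fin d) ℝ) (u : ℝ) :
    ℕ → ℝ → Matrix (Fin d) (Fin d) ℝ
  | 0, _ => 1
  | n + 1, s => matIntegral (fun r => A r * iteratedIntegral A u n r) u s

/-- The time-ordered exponential `exp (∫_u^s A(r) dr)` of a locally integrable matrix function `A`,
i.e. the transition matrix from time `u` to time `s` of the linear equation `x' = A x`, the
solution of `∂Ψ/∂s (s, u) = A(s) Ψ(s, u)`, `Ψ(u, u) = 1`, given by its Peano-Baker series. -/
def orderedExp {d : ℕ} (A : ℝ → Matrix (Fin d) (Fin d) ℝ) (u s : ℝ) :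
    Matrix (Fin d) (Fin d) ℝ :=
  ∑' n : ℕ, iteratedIntegral A u n s

/-! ### The coefficients of the linear system and the Riccati equations -/

/-- The standing assumptions on the coefficients: `a` is locally integrable, `b`, `c`, `σ` are
locally square integrable on `[0, ∞)`, and the eigenvalues of `σ σᵀ` are bounded below by a positive
constant. -/
structure CoefficientAssumptions {d₁ d₂ m₁ m₂ : ℕ} (a : ℝ → Matrix (Fin d₁) (Fin d₁) ℝ)
    (b : ℝ → Matrix (Fin d₁) (Fin m₁) ℝ) (c : ℝ → Matrix (Fin d₂) (Fin d₁) ℝ)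
    (σ : ℝ → Matrix (Fin d₂) (Fin m₂) ℝ) : Prop where
  integrable_a : ∀ T : ℝ, 0 ≤ T → ∀ i j,
    IntegrableOn (fun r => a r i j) (Icc 0 T)
  memLp_b : ∀ T : ℝ, 0 ≤ T → ∀ i j,
    MemLp (fun r => b r i j) 2 (volume.restrict (Icc 0 T))
  memLp_c : ∀ T : ℝ, 0 ≤ T → ∀ i j,
    MemLp (fun r => c r i j) 2 (volume.restrict (Icc 0 T))
  memLp_σ : ∀ T : ℝ, 0 ≤ T → ∀ i j,
    MemLp (fun r => σ r i j) 2 (volume.restrict (Icc 0 T))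
  nondegenerate : ∃ C : ℝ, 0 < C ∧
    ∀ r : ℝ, 0 ≤ r → ∀ l ∈ spectrum ℝ (σ r * (σ r)ᵀ), C < l

/-- `c(r)ᵀ (σ(r) σ(r)ᵀ)⁻¹ c(r)`. -/
def obsInfo {d₁ d₂ m₂ : ℕ} (c : ℝ → Matrix (Fin d₂) (Fin d₁) ℝ)
    (σ : ℝ → Matrix (Fin d₂) (Fin m₂) ℝ) (r : ℝ) : Matrix (Fin d₁) (Fin d₁) ℝ :=
  (c r)ᵀ * (σ r * (σ r)ᵀ)⁻¹ * c r

/-- `φ = φ(·; t)` is a negative semidefinite symmetric solution on `[0, t]` of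
`φ' = -φ b bᵀ φ - aᵀ φ - φ a + cᵀ (σ σᵀ)⁻¹ c`, `φ(t) = 0`. The coefficients being only measurable,
solutions are continuous functions satisfying the integrated equation. -/
structure IsBackwardRiccati {d₁ d₂ m₁ m₂ : ℕ} (a : ℝ → Matrix (Fin d₁) (Fin d₁) ℝ)
    (b : ℝ → Matrix (Fin d₁) (Fin m₁) ℝ) (c : ℝ → Matrix (Fin d₂) (Fin d₁) ℝ)
    (σ : ℝ → Matrix (Fin d₂) (Fin m₂) ℝ) (t : ℝ) (φ : ℝ → Matrix (Fin d₁) (Fin d₁) ℝ) :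
    Prop where
  continuousOn : ContinuousOn φ (Icc 0 t)
  negSemidef : ∀ s ∈ Icc 0 t, (-φ s).PosSemidef
  equation : ∀ s ∈ Icc 0 t, φ s = -matIntegral (fun r =>
    -(φ r * (b r * (b r)ᵀ) * φ r) - (a r)ᵀ * φ r - φ r * a r + obsInfo c σ r) s t

/-- `γ` is a positive semidefinite (symmetric) solution on `[0, ∞)` of
`γ' = -γ cᵀ (σ σᵀ)⁻¹ c γ + a γ + γ aᵀ + b bᵀ`, `γ(0) = S₀`, in the same integrated sense. -/
structure IsForwardRiccati {d₁ d₂ m₁ m₂ : ℕ} (a : ℝ → Matrix (Fin d₁) (Fin d₁) ℝ)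
    (b : ℝ → Matrix (Fin d₁) (Fin m₁) ℝ) (c : ℝ → Matrix (Fin d₂) (Fin d₁) ℝ)
    (σ : ℝ → Matrix (Fin d₂) (Fin m₂) ℝ) (S₀ : Matrix (Fin d₁) (Fin d₁) ℝ)
    (γ : ℝ → Matrix (Fin d₁) (Fin d₁) ℝ) : Prop where
  continuousOn : ContinuousOn γ (Ici 0)
  posSemidef : ∀ s, 0 ≤ s → (γ s).PosSemidef
  equation : ∀ s, 0 ≤ s → γ s = S₀ + matIntegral (fun r =>
    -(γ r * obsInfo c σ r * γ r) + a r * γ r + γ r * (a r)ᵀ + b r * (b r)ᵀ) 0 s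

/-! ### Covariance matrices, Brownian motion and the linear stochastic equation -/

variable {Ω : Type*} [MeasurableSpace Ω]

/-- The covariance matrix `Cov(X, Y) = E[(X - E X)(Y - E Y)ᵀ]` of two random vectors. -/
def covMatrix {d e : ℕ} (P : Measure Ω) (X : Ω → Fin d → ℝ) (Y : Ω → Fin e → ℝ) :
    Matrix (Fin d) (Fin e) ℝ :=
  Matrix.of fun i j => cov[fun ω => X ω i, fun ω => Y ω j; P]

/-- `V` is an `m`-dimensional standard Brownian motion: its coordinates are independent real
Brownian motions. -/
structure IsBrownianVec {m : ℕ} (P : Measure Ω) (V : ℝ≥0 → Ω → Fin m → ℝ) : Prop where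
  isBrownian : ∀ i, IsBrownianReal (fun r ω => V r ω i) P
  indep : iIndepFun (fun (i : Fin m) (ω : Ω) (r : ℝ≥0) => V r ω i) P

/-- A deterministic matrix step function `∑_{k < N} F_k 1_{(p_k, p_{k+1}]}` with
`0 ≤ p_0 ≤ p_1 ≤ ⋯`. -/
structure StepFun (d m : ℕ) where
  N : ℕ
  node : ℕ → ℝ≥0
  mono : Monotone node
  val : ℕ → Matrix (Fin d) (Fin m) ℝ

/-- The function `ℝ → Matrix` represented by a step function. -/
def StepFun.eval {d m : ℕ} (f : StepFun d m) (r : ℝ) : Matrix (Fin d) (Fin m) ℝ :=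
  ∑ k ∈ Finset.range f.N,
    (Ioc (f.node k : ℝ) (f.node (k + 1) : ℝ)).indicator (fun _ => f.val k) r

/-- The stochastic integral `∑_{k < N} F_k (V(p_{k+1}) - V(p_k))` of a step function. -/
def StepFun.stochInt {d m : ℕ} (f : StepFun d m) (V : ℝ≥0 → Ω → Fin m → ℝ) (ω : Ω) :
    Fin d → ℝ :=
  ∑ k ∈ Finset.range f.N, f.val k *ᵥ (V (f.node (k + 1)) ω - V (f.node k) ω)

/-- The random vector `I` is (a version of) the stochastic integral `∫_0^s b(r) dV_r` of the
deterministic function `b`: the `L²(P)`-limit of the integrals of step functions on `[0, s]`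
converging to `b` in `L²([0, s])`. -/
def IsStochInt {d m : ℕ} (P : Measure Ω) (V : ℝ≥0 → Ω → Fin m → ℝ)
    (b : ℝ → Matrix (Fin d) (Fin m) ℝ) (s : ℝ) (I : Ω → Fin d → ℝ) : Prop :=
  ∃ f : ℕ → StepFun d m,
    (∀ n, ((f n).node (f n).N : ℝ) ≤ s) ∧
    (∀ i j, Tendsto
      (fun n => eLpNorm (fun r => (f n).eval r i j - b r i j) 2 (volume.restrict (Icc 0 s)))
      atTop (𝓝 0)) ∧
    Tendsto (fun n => eLpNorm (fun ω => (f n).stochInt V ω - I ω) 2 P) atTop (𝓝 0)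

/-- `X` is a solution on `[0, t]` of the linear stochastic differential equation
`dX_s = A(s) X_s ds + b(s) dV_s`: it has almost surely continuous paths and, for every `s ∈ [0, t]`,
`X_s - X_0 - ∫_0^s A(r) X_r dr = ∫_0^s b(r) dV_r` almost surely. -/
structure IsLinearSDESolution {d m : ℕ} (P : Measure Ω) (A : ℝ → Matrix (Fin d) (Fin d) ℝ)
    (b : ℝ → Matrix (Fin d) (Fin m) ℝ) (V : ℝ≥0 → Ω → Fin m → ℝ) (t : ℝ)
    (X : ℝ → Ω → Fin d → ℝ) : Prop where
  aemeasurable : ∀ s ∈ Icc 0 t, AEMeasurable (X s) P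
  continuousOn : ∀ᵐ ω ∂P, ContinuousOn (fun s => X s ω) (Icc 0 t)
  equation : ∀ s ∈ Icc 0 t, IsStochInt P V b s
    (fun ω => X s ω - X 0 ω - ∫ r in (0 : ℝ)..s, A r *ᵥ X r ω)

/-- The process `ξ = (ξ_{s;t})_{0 ≤ s ≤ t}`: the solution on `[0, t]` of
`dξ_s = (a(s) + b(s) b(s)ᵀ φ(s)) ξ_s ds + b(s) dV_s`, driven by a Brownian motion `V`, whose initial
value is Gaussian, independent of `V`, with mean zero and covariance matrix
`S₀^{1/2} (1 - S₀^{1/2} φ(0) S₀^{1/2})⁻¹ S₀^{1/2}`. -/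
structure IsSmoothingProcess {d₁ m₁ : ℕ} (P : Measure Ω) (a : ℝ → Matrix (Fin d₁) (Fin d₁) ℝ)
    (b : ℝ → Matrix (Fin d₁) (Fin m₁) ℝ) (S₀ : Matrix (Fin d₁) (Fin d₁) ℝ)
    (φ : ℝ → Matrix (Fin d₁) (Fin d₁) ℝ) (V : ℝ≥0 → Ω → Fin m₁ → ℝ) (t : ℝ)
    (ξ : ℝ → Ω → Fin d₁ → ℝ) : Prop where
  brownian : IsBrownianVec P V
  solution : IsLinearSDESolution P (fun s => a s + b s * (b s)ᵀ * φ s) b V t ξ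
  gaussian_init : HasGaussianLaw (ξ 0) P
  indep_init : IndepFun (ξ 0) (fun ω (r : ℝ≥0) => V r ω) P
  mean_init : ∫ ω, ξ 0 ω ∂P = 0
  cov_init : covMatrix P (ξ 0) (ξ 0) =
    CFC.sqrt S₀ * (1 - CFC.sqrt S₀ * φ 0 * CFC.sqrt S₀)⁻¹ * CFC.sqrt S₀

end

end LinearSmoothing

/-!
The proof writes every solution through fundamental matrices, so that no uniqueness theorem for
the Riccati or the stochastic equation is needed. Absolutely continuous functions are handled
through their integrated equations (`PrimitiveOn`, `MatPrimitiveOn`), for which Leibniz' rule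
holds; an identity between such functions is proved by multiplying with integrating factors and
checking that the derivative of the result vanishes.

*Deterministic part.* Let `F = a - γ G` be the filter generator, with fundamental matrix `Ψ` given
by the Peano-Baker series (`exists_isFundamentalOn`) and inverse `Θ`, and let `A = a + b bᵀ φ` be
the smoothing generator, with fundamental matrix `M` and inverse `J`. The gramian
`N(s) = ∫_s^t Ψ(v, s)ᵀ G(v) Ψ(v, s) dv` solves `N' = -G - Fᵀ N - N F`, `N(t) = 0`, and therefore
`(1 - φ γ) N + φ = 0` (`RiccatiPair.gramian_add_eq_zero`). Hence `L = 1 - γ N` is the inverse of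
`1 - γ φ`, it satisfies `L' = A L - L F`, so it conjugates the two transition matrices
(`RiccatiPair.transition_eq`), and `L γ` solves the Lyapunov equation of the smoothing process
(`RiccatiPair.matPrimitiveOn_conj`), with the right value at time zero (`sqrt_mul_inv_mul_sqrt`).

*Stochastic part.* The solution is a linear functional of its driving part
`Y_s = ξ_s - ∫_0^s A ξ = ξ_0 + ∫_0^s b dV`, namely `ξ_s = Y_s + M(s) ∫_0^s J A Y dr`, along almost
every path (`IsCenteredSolution.eq_sdeNoise_add`). The covariance
`Cov(Y_s, Y_w) = Cov(ξ_0) + ∫_0^{s ∧ w} b bᵀ` is the Itô isometry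
(`IsStochInt.integral_mul_integral`), obtained from step functions by continuity. Fubini's theorem
for `∫ β Y dr` (`IsL2Process.integral_integral_mul`) transfers the linear equation to moments, and
two applications give `Cov(ξ_s, ξ_u) = M(s) (Cov(ξ_0) + ∫_0^u J b bᵀ Jᵀ) M(u)ᵀ`
(`IsCenteredSolution.covMatrix_eq`). By the deterministic part this is
`M(s) J(u) L(u) γ(u) = L(s) Ψ(s, u) γ(u)`, the asserted formula.
-/

namespace LinearSmoothing

/-! ### Primitives of integrable functions -/

/-- On `[u, t]` the function `f` is absolutely continuous with almost everywhere derivative `f'`,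
stated in integrated form: `f s = f u + ∫_u^s f'`. -/
structure PrimitiveOn (u t : ℝ) (f f' : ℝ → ℝ) : Prop where
  le : u ≤ t
  integrable : IntervalIntegrable f' volume u t
  eq : ∀ s ∈ Icc u t, f s = f u + ∫ r in u..s, f' r

namespace PrimitiveOn

variable {u t : ℝ} {f f' g g' : ℝ → ℝ}

lemma const (h : u ≤ t) (x : ℝ) : PrimitiveOn u t (fun _ => x) (fun _ => 0) :=
  ⟨h, by simp, by simp⟩

lemma congr (hf : PrimitiveOn u t f f') (h : ∀ s ∈ Icc u t, g s = f s)
    (h' : ∀ s ∈ Icc u t, g' s = f' s) : PrimitiveOn u t g g' := by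
  refine ⟨hf.le, ?_, fun s hs => ?_⟩
  · refine hf.integrable.congr fun s hs => ?_
    rw [uIoc_of_le hf.le] at hs
    exact (h' s (Ioc_subset_Icc_self hs)).symm
  · rw [h s hs, h u (left_mem_Icc.2 hf.le), hf.eq s hs]
    congr 1
    refine intervalIntegral.integral_congr fun r hr => ?_
    rw [uIcc_of_le hs.1] at hr
    exact (h' r ⟨hr.1, hr.2.trans hs.2⟩).symm

lemma intervalIntegrable_left (hf : PrimitiveOn u t f f') {s : ℝ} (hs : s ∈ Icc u t) :
    IntervalIntegrable f' volume u s :=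
  hf.integrable.mono_set (by
    rw [uIcc_of_le hs.1, uIcc_of_le hf.le]; exact Icc_subset_Icc le_rfl hs.2)

lemma restrict (hf : PrimitiveOn u t f f') {v w : ℝ} (huv : u ≤ v) (hvw : v ≤ w) (hwt : w ≤ t) :
    PrimitiveOn v w f f' := by
  have hv : v ∈ Icc u t := ⟨huv, hvw.trans hwt⟩
  refine ⟨hvw, hf.integrable.mono_set ?_, fun s hs => ?_⟩
  · rw [uIcc_of_le hvw, uIcc_of_le hf.le]
    exact Icc_subset_Icc huv hwt
  · have hs' : s ∈ Icc u t := ⟨huv.trans hs.1, hs.2.trans hwt⟩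
    have h1 := hf.intervalIntegrable_left hv
    have h2 := hf.intervalIntegrable_left hs'
    rw [hf.eq s hs', hf.eq v hv, add_assoc,
      intervalIntegral.integral_add_adjacent_intervals h1 (h1.symm.trans h2)]

lemma add (hf : PrimitiveOn u t f f') (hg : PrimitiveOn u t g g') :
    PrimitiveOn u t (fun s => f s + g s) (fun s => f' s + g' s) := by
  refine ⟨hf.le, hf.integrable.add hg.integrable, fun s hs => ?_⟩
  rw [intervalIntegral.integral_add (hf.intervalIntegrable_left hs) (hg.intervalIntegrable_left hs),
    hf.eq s hs, hg.eq s hs]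
  ring

lemma neg (hf : PrimitiveOn u t f f') : PrimitiveOn u t (fun s => -f s) (fun s => -f' s) := by
  refine ⟨hf.le, hf.integrable.neg, fun s hs => ?_⟩
  rw [intervalIntegral.integral_neg, hf.eq s hs]
  ring

lemma sum {ι : Type*} (S : Finset ι) (h : u ≤ t) {f f' : ι → ℝ → ℝ}
    (hf : ∀ i ∈ S, PrimitiveOn u t (f i) (f' i)) :
    PrimitiveOn u t (fun s => ∑ i ∈ S, f i s) (fun s => ∑ i ∈ S, f' i s) := by
  classical
  induction S using Finset.induction_on with
  | empty => simpa using const h 0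
  | insert a S ha ih =>
    simp only [Finset.sum_insert ha]
    exact (hf a (by simp)).add (ih fun i hi => hf i (by simp [hi]))

lemma integral (h : u ≤ t) (hf : IntervalIntegrable f' volume u t) (x : ℝ) :
    PrimitiveOn u t (fun s => x + ∫ r in u..s, f' r) f' :=
  ⟨h, hf, fun s _ => by simp⟩

lemma absolutelyContinuousOnInterval_add_integral (hf : PrimitiveOn u t f f') :
    AbsolutelyContinuousOnInterval (fun s => f u + ∫ r in u..s, f' r) u t := by
  have h := hf.integrable.absolutelyContinuousOnInterval_intervalIntegral (c := u) (by simp)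
  have h0 : AbsolutelyContinuousOnInterval (fun _ : ℝ => f u) u t :=
    (LipschitzWith.const (f u)).lipschitzOnWith.absolutelyContinuousOnInterval
  exact h0.add h

lemma continuousOn (hf : PrimitiveOn u t f f') : ContinuousOn f (Icc u t) := by
  have h := hf.absolutelyContinuousOnInterval_add_integral.continuousOn
  rw [uIcc_of_le hf.le] at h
  exact h.congr hf.eq

/-- Leibniz' rule. -/
lemma mul (hf : PrimitiveOn u t f f') (hg : PrimitiveOn u t g g') :
    PrimitiveOn u t (fun s => f s * g s) (fun s => f' s * g s + f s * g' s) := by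
  have hle := uIcc_of_le hf.le
  have hf1 := hf.integrable.mul_continuousOn (hle ▸ hg.continuousOn)
  have hg1 := hg.integrable.continuousOn_mul (hle ▸ hf.continuousOn)
  refine ⟨hf.le, hf1.add hg1, fun s hs => ?_⟩
  have hf2 := hf.restrict le_rfl hs.1 hs.2
  have hg2 := hg.restrict le_rfl hs.1 hs.2
  have key := hf2.absolutelyContinuousOnInterval_add_integral.integral_deriv_mul_eq_sub
    hg2.absolutelyContinuousOnInterval_add_integral
  have hr := right_mem_Icc.2 hs.1
  rw [← hf2.eq s hr, ← hg2.eq s hr] at key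
  simp only [intervalIntegral.integral_same, add_zero] at key
  rw [← sub_eq_iff_eq_add', ← key]
  refine intervalIntegral.integral_congr_ae ?_
  filter_upwards [hf2.integrable.ae_hasDerivAt_integral, hg2.integrable.ae_hasDerivAt_integral]
    with r h1 h2 hr
  have hr' : r ∈ uIcc u s := uIoc_subset_uIcc hr
  rw [((h1 hr' u (by simp)).const_add (f u)).deriv, ((h2 hr' u (by simp)).const_add (g u)).deriv]
  rw [uIcc_of_le hs.1] at hr'
  rw [← hf2.eq r hr', ← hg2.eq r hr']

lemma eq_of_deriv_eq_zero (hf : PrimitiveOn u t f f') (h : ∀ s ∈ Icc u t, f' s = 0) {s : ℝ}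
    (hs : s ∈ Icc u t) : f s = f u := by
  have h0 : PrimitiveOn u t f fun _ => 0 := hf.congr (fun _ _ => rfl) fun r hr => (h r hr).symm
  simpa using h0.eq s hs

/-- The derivative of `K ^ (n + 1) / (n + 1)!` is `K ^ n / n! * K'`. -/
lemma pow_div_factorial (hf : PrimitiveOn u t f f') (n : ℕ) :
    PrimitiveOn u t (fun s => f s ^ (n + 1) / (n + 1).factorial)
      (fun s => f s ^ n / n.factorial * f' s) := by
  induction n with
  | zero => simpa using hf
  | succ n ih =>
    have h := (ih.mul hf).mul (const hf.le ((n + 2 : ℝ)⁻¹))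
    have h1 : ((n : ℝ) + 1 + 1) ≠ 0 := by positivity
    have h2 : ((n : ℝ) + 2) ≠ 0 := by positivity
    have h3 : ((n + 1).factorial : ℝ) ≠ 0 := by positivity
    have h4 : ((n).factorial : ℝ) ≠ 0 := by positivity
    refine h.congr (fun s _ => ?_) fun s _ => ?_
    · rw [Nat.factorial_succ (n + 1)]
      push_cast
      field_simp
      ring
    · rw [Nat.factorial_succ n]
      push_cast
      field_simp
      ring

end PrimitiveOn

/-- The entrywise version of `PrimitiveOn` for matrix functions. -/
def MatPrimitiveOn {m n : Type*} (u t : ℝ) (f f' : ℝ → Matrix m n ℝ) : Prop :=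
  ∀ i j, PrimitiveOn u t (fun s => f s i j) (fun s => f' s i j)

/-- Entrywise integrability of a matrix function on `[u, t]`. -/
def MatIntegrableOn {m n : Type*} (u t : ℝ) (f : ℝ → Matrix m n ℝ) : Prop :=
  ∀ i j, IntervalIntegrable (fun s => f s i j) volume u t

namespace MatPrimitiveOn

variable {l m n : Type*} {u t : ℝ}

lemma integrable {f f' : ℝ → Matrix m n ℝ} (hf : MatPrimitiveOn u t f f') :
    MatIntegrableOn u t f' := fun i j => (hf i j).integrable

lemma continuousOn {f f' : ℝ → Matrix m n ℝ} (hf : MatPrimitiveOn u t f f') :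
    ContinuousOn f (Icc u t) :=
  continuousOn_pi.2 fun i => continuousOn_pi.2 fun j => (hf i j).continuousOn

lemma const (h : u ≤ t) (x : Matrix m n ℝ) : MatPrimitiveOn u t (fun _ => x) (fun _ => 0) :=
  fun i j => PrimitiveOn.const h (x i j)

lemma congr {f f' g g' : ℝ → Matrix m n ℝ} (hf : MatPrimitiveOn u t f f')
    (h : ∀ s ∈ Icc u t, g s = f s) (h' : ∀ s ∈ Icc u t, g' s = f' s) :
    MatPrimitiveOn u t g g' :=
  fun i j => (hf i j).congr (fun s hs => by rw [h s hs]) fun s hs => by rw [h' s hs]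

lemma restrict {f f' : ℝ → Matrix m n ℝ} (hf : MatPrimitiveOn u t f f') {v w : ℝ} (huv : u ≤ v)
    (hvw : v ≤ w) (hwt : w ≤ t) : MatPrimitiveOn v w f f' :=
  fun i j => (hf i j).restrict huv hvw hwt

lemma transpose {f f' : ℝ → Matrix m n ℝ} (hf : MatPrimitiveOn u t f f') :
    MatPrimitiveOn u t (fun s => (f s)ᵀ) (fun s => (f' s)ᵀ) :=
  fun i j => hf j i

lemma add {f f' g g' : ℝ → Matrix m n ℝ} (hf : MatPrimitiveOn u t f f')
    (hg : MatPrimitiveOn u t g g') :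
    MatPrimitiveOn u t (fun s => f s + g s) (fun s => f' s + g' s) :=
  fun i j => (hf i j).add (hg i j)

lemma neg {f f' : ℝ → Matrix m n ℝ} (hf : MatPrimitiveOn u t f f') :
    MatPrimitiveOn u t (fun s => -f s) (fun s => -f' s) :=
  fun i j => (hf i j).neg

lemma sub {f f' g g' : ℝ → Matrix m n ℝ} (hf : MatPrimitiveOn u t f f')
    (hg : MatPrimitiveOn u t g g') :
    MatPrimitiveOn u t (fun s => f s - g s) (fun s => f' s - g' s) := by
  simpa only [sub_eq_add_neg] using hf.add hg.neg

lemma mul [Fintype m] {f f' : ℝ → Matrix l m ℝ} {g g' : ℝ → Matrix m n ℝ} (h : u ≤ t)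
    (hf : MatPrimitiveOn u t f f') (hg : MatPrimitiveOn u t g g') :
    MatPrimitiveOn u t (fun s => f s * g s) (fun s => f' s * g s + f s * g' s) := fun i j => by
  have := PrimitiveOn.sum Finset.univ h (fun k _ => (hf i k).mul (hg k j))
  simpa only [Matrix.mul_apply, Matrix.add_apply, ← Finset.sum_add_distrib] using this

lemma eq_of_deriv_eq_zero {f f' : ℝ → Matrix m n ℝ} (hf : MatPrimitiveOn u t f f')
    (h : ∀ s ∈ Icc u t, f' s = 0) {s : ℝ} (hs : s ∈ Icc u t) : f s = f u := by
  ext i j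
  exact (hf i j).eq_of_deriv_eq_zero (fun r hr => by simp [h r hr]) hs

lemma eq_matIntegral {d e : ℕ} {f f' : ℝ → Matrix (Fin d) (Fin e) ℝ}
    (hf : MatPrimitiveOn u t f f') {s : ℝ} (hs : s ∈ Icc u t) :
    f s = f u + matIntegral f' u s := by
  ext i j
  exact (hf i j).eq s hs

end MatPrimitiveOn

namespace MatIntegrableOn

variable {l m n : Type*} {u t : ℝ}

lemma mono {f : ℝ → Matrix m n ℝ} (hf : MatIntegrableOn u t f) {v w : ℝ} (huv : u ≤ v)
    (hvw : v ≤ w) (hwt : w ≤ t) : MatIntegrableOn v w f := fun i j =>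
  (hf i j).mono_set (by
    rw [uIcc_of_le hvw, uIcc_of_le (huv.trans (hvw.trans hwt))]
    exact Icc_subset_Icc huv hwt)

lemma transpose {f : ℝ → Matrix m n ℝ} (hf : MatIntegrableOn u t f) :
    MatIntegrableOn u t fun s => (f s)ᵀ := fun i j => hf j i

lemma add {f g : ℝ → Matrix m n ℝ} (hf : MatIntegrableOn u t f) (hg : MatIntegrableOn u t g) :
    MatIntegrableOn u t fun s => f s + g s := fun i j => (hf i j).add (hg i j)

lemma neg {f : ℝ → Matrix m n ℝ} (hf : MatIntegrableOn u t f) :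
    MatIntegrableOn u t fun s => -f s := fun i j => (hf i j).neg

lemma sub {f g : ℝ → Matrix m n ℝ} (hf : MatIntegrableOn u t f) (hg : MatIntegrableOn u t g) :
    MatIntegrableOn u t fun s => f s - g s := fun i j => (hf i j).sub (hg i j)

lemma mul_continuousOn [Fintype m] {f : ℝ → Matrix l m ℝ} {g : ℝ → Matrix m n ℝ} (h : u ≤ t)
    (hf : MatIntegrableOn u t f) (hg : ContinuousOn g (Icc u t)) :
    MatIntegrableOn u t fun s => f s * g s := fun i j => by
  simp only [Matrix.mul_apply]
  have := IntervalIntegrable.sum (a := u) (b := t) (μ := volume) Finset.univ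
    (f := fun k s => f s i k * g s k j) fun k _ => (hf i k).mul_continuousOn (by
      rw [uIcc_of_le h]
      exact continuousOn_pi.1 (continuousOn_pi.1 hg k) j)
  simpa only [Finset.sum_fn] using this

lemma continuousOn_mul [Fintype m] {f : ℝ → Matrix l m ℝ} {g : ℝ → Matrix m n ℝ} (h : u ≤ t)
    (hf : ContinuousOn f (Icc u t)) (hg : MatIntegrableOn u t g) :
    MatIntegrableOn u t fun s => f s * g s := by
  have := (hg.transpose.mul_continuousOn h (g := fun s => (f s)ᵀ)
    (continuous_id.matrix_transpose.comp_continuousOn hf)).transpose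
  simpa only [Matrix.transpose_mul, Matrix.transpose_transpose] using this

lemma matPrimitiveOn {d e : ℕ} {f : ℝ → Matrix (Fin d) (Fin e) ℝ} (h : u ≤ t)
    (hf : MatIntegrableOn u t f) (x : Matrix (Fin d) (Fin e) ℝ) :
    MatPrimitiveOn u t (fun s => x + matIntegral f u s) f :=
  fun i j => PrimitiveOn.integral h (hf i j) (x i j)

end MatIntegrableOn

/-! ### The Peano-Baker series -/

/-- The sum of the absolute values of the entries of a matrix, a submultiplicative norm. -/
def entrySum {m n : Type*} [Fintype m] [Fintype n] (M : Matrix m n ℝ) : ℝ :=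
  ∑ i, ∑ j, |M i j|

section entrySum

variable {l m n : Type*} [Fintype l] [Fintype m] [Fintype n]

lemma entrySum_nonneg (M : Matrix m n ℝ) : 0 ≤ entrySum M :=
  Finset.sum_nonneg fun _ _ => Finset.sum_nonneg fun _ _ => abs_nonneg _

lemma abs_le_entrySum (M : Matrix m n ℝ) (i : m) (j : n) : |M i j| ≤ entrySum M :=
  (Finset.single_le_sum (f := fun j => |M i j|) (fun _ _ => abs_nonneg _) (Finset.mem_univ j)).trans
    (Finset.single_le_sum (f := fun i => ∑ j, |M i j|)
      (fun _ _ => Finset.sum_nonneg fun _ _ => abs_nonneg _) (Finset.mem_univ i))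

lemma entrySum_mul_le (M : Matrix l m ℝ) (N : Matrix m n ℝ) :
    entrySum (M * N) ≤ entrySum M * entrySum N := by
  have h1 : ∀ k, ∑ j, |N k j| ≤ entrySum N := fun k =>
    Finset.single_le_sum (f := fun k => ∑ j, |N k j|)
      (fun _ _ => Finset.sum_nonneg fun _ _ => abs_nonneg _) (Finset.mem_univ k)
  have h2 : ∀ i, ∑ j, |(M * N) i j| ≤ (∑ k, |M i k|) * entrySum N := fun i => by
    calc ∑ j, |(M * N) i j| ≤ ∑ j, ∑ k, |M i k| * |N k j| := Finset.sum_le_sum fun j _ => by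
          rw [Matrix.mul_apply]
          refine (Finset.abs_sum_le_sum_abs _ _).trans_eq ?_
          simp only [abs_mul]
      _ = ∑ k, |M i k| * ∑ j, |N k j| := by
          rw [Finset.sum_comm]
          simp only [Finset.mul_sum]
      _ ≤ (∑ k, |M i k|) * entrySum N := by
          rw [Finset.sum_mul]
          exact Finset.sum_le_sum fun k _ => mul_le_mul_of_nonneg_left (h1 k) (abs_nonneg _)
  calc entrySum (M * N) ≤ ∑ i, (∑ k, |M i k|) * entrySum N := Finset.sum_le_sum fun i _ => h2 i
    _ = entrySum M * entrySum N := by rw [← Finset.sum_mul]; rfl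

lemma MatIntegrableOn.intervalIntegrable_entrySum {u t : ℝ} {f : ℝ → Matrix m n ℝ}
    (hf : MatIntegrableOn u t f) :
    IntervalIntegrable (fun s => entrySum (f s)) volume u t := by
  have := IntervalIntegrable.sum (a := u) (b := t) (μ := volume) Finset.univ
    (f := fun i s => ∑ j, |f s i j|) fun i _ => by
      have := IntervalIntegrable.sum (a := u) (b := t) (μ := volume) Finset.univ
        (f := fun j s => |f s i j|) fun j _ => (hf i j).abs
      simpa only [Finset.sum_fn] using this
  simp only [Finset.sum_fn] at this
  exact this

lemma entrySum_matIntegral_le {d e : ℕ} {u t : ℝ} (h : u ≤ t)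
    {f : ℝ → Matrix (Fin d) (Fin e) ℝ} (hf : MatIntegrableOn u t f) :
    entrySum (matIntegral f u t)
      ≤ ∫ r in u..t, entrySum (f r) := by
  have h1 : ∫ r in u..t, entrySum (f r) = ∑ i, ∑ j, ∫ r in u..t, |f r i j| := by
    unfold entrySum
    rw [intervalIntegral.integral_finsetSum fun i _ => by
      simpa only [Finset.sum_fn] using
        IntervalIntegrable.sum (a := u) (b := t) (μ := volume) Finset.univ
          (f := fun j s => |f s i j|) fun j _ => (hf i j).abs]
    exact Finset.sum_congr rfl fun i _ => intervalIntegral.integral_finsetSum fun j _ =>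
      (hf i j).abs
  rw [h1]
  exact Finset.sum_le_sum fun i _ => Finset.sum_le_sum fun j _ =>
    intervalIntegral.abs_integral_le_integral_abs h

end entrySum

section PeanoBaker

variable {d : ℕ} {u t : ℝ} {A : ℝ → Matrix (Fin d) (Fin d) ℝ}

lemma continuousOn_iteratedIntegral (h : u ≤ t) (hA : MatIntegrableOn u t A) (n : ℕ) :
    ContinuousOn (iteratedIntegral A u n) (Icc u t) := by
  induction n with
  | zero => exact continuousOn_const
  | succ n ih =>
    have := ((hA.mul_continuousOn h ih).matPrimitiveOn h 0).continuousOn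
    simp only [zero_add] at this
    exact this

lemma entrySum_iteratedIntegral_le (h : u ≤ t) (hA : MatIntegrableOn u t A) (n : ℕ) :
    ∀ s ∈ Icc u t, entrySum (iteratedIntegral A u n s)
      ≤ d * ((∫ r in u..s, entrySum (A r)) ^ n / n.factorial) := by
  have hK := PrimitiveOn.integral h hA.intervalIntegrable_entrySum 0
  simp only [zero_add] at hK
  induction n with
  | zero =>
    intro s _
    have : entrySum (1 : Matrix (Fin d) (Fin d) ℝ) = d := by
      unfold entrySum
      simp only [Matrix.one_apply, apply_ite abs, abs_one, abs_zero]
      simp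
    simp [iteratedIntegral, this]
  | succ n ih =>
    intro s hs
    have hP := (hK.pow_div_factorial n).restrict le_rfl hs.1 hs.2
    have hI := (hA.mul_continuousOn h (continuousOn_iteratedIntegral h hA n)).mono le_rfl hs.1 hs.2
    have hs' := right_mem_Icc.2 hs.1
    have hK0 := hP.eq s hs'
    simp only [intervalIntegral.integral_same, ne_eq, Nat.add_eq_zero_iff, one_ne_zero, and_false,
      not_false_eq_true, zero_pow, zero_div, zero_add] at hK0
    rw [hK0, ← intervalIntegral.integral_const_mul]
    refine (entrySum_matIntegral_le hs.1 hI).trans ?_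
    refine intervalIntegral.integral_mono_on hs.1 hI.intervalIntegrable_entrySum
      (hP.integrable.const_mul _) fun r hr => ?_
    refine (entrySum_mul_le _ _).trans ?_
    have := mul_le_mul_of_nonneg_left (ih r ⟨hr.1, hr.2.trans hs.2⟩) (entrySum_nonneg (A r))
    refine this.trans_eq (by ring)

/-- The terms of the Peano-Baker series are bounded, uniformly on `[u, t]`, by the terms of an
exponential series. -/
lemma abs_iteratedIntegral_le (h : u ≤ t) (hA : MatIntegrableOn u t A) (n : ℕ) {s : ℝ}
    (hs : s ∈ Icc u t) (i j : Fin d) : |iteratedIntegral A u n s i j|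
      ≤ d * ((∫ r in u..t, entrySum (A r)) ^ n / n.factorial) := by
  refine (abs_le_entrySum _ i j).trans ((entrySum_iteratedIntegral_le h hA n s hs).trans ?_)
  have h1 : ∫ r in u..s, entrySum (A r) ≤ ∫ r in u..t, entrySum (A r) :=
    intervalIntegral.integral_mono_interval le_rfl hs.1 hs.2
      (Eventually.of_forall fun r => entrySum_nonneg _) hA.intervalIntegrable_entrySum
  have h0 : 0 ≤ ∫ r in u..s, entrySum (A r) :=
    intervalIntegral.integral_nonneg hs.1 fun r _ => entrySum_nonneg _
  gcongr

lemma summable_iteratedIntegral_bound (x y : ℝ) :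
    Summable fun n : ℕ => y * (x ^ n / n.factorial) :=
  (Real.summable_pow_div_factorial x).mul_left y

lemma hasSum_iteratedIntegral (h : u ≤ t) (hA : MatIntegrableOn u t A) {s : ℝ}
    (hs : s ∈ Icc u t) (i j : Fin d) :
    HasSum (fun n => iteratedIntegral A u n s i j) (orderedExp A u s i j) := by
  have h1 : ∀ i j, Summable fun n => iteratedIntegral A u n s i j := fun i j =>
    Summable.of_norm_bounded (summable_iteratedIntegral_bound _ _) fun n =>
      abs_iteratedIntegral_le h hA n hs i j
  have h2 : Summable fun n => iteratedIntegral A u n s :=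
    Pi.summable.2 fun i => Pi.summable.2 fun j => h1 i j
  exact Pi.hasSum.1 (Pi.hasSum.1 h2.hasSum i) j

lemma continuousOn_orderedExp (h : u ≤ t) (hA : MatIntegrableOn u t A) :
    ContinuousOn (orderedExp A u) (Icc u t) := by
  refine continuousOn_pi.2 fun i => continuousOn_pi.2 fun j => ?_
  refine ContinuousOn.congr (continuousOn_tsum (fun n => ?_) (summable_iteratedIntegral_bound _ _)
    fun n s hs => abs_iteratedIntegral_le h hA n hs i j) fun s hs =>
      (hasSum_iteratedIntegral h hA hs i j).tsum_eq.symm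
  exact continuousOn_pi.1 (continuousOn_pi.1 (continuousOn_iteratedIntegral h hA n) i) j

lemma orderedExp_self (A : ℝ → Matrix (Fin d) (Fin d) ℝ) (u : ℝ) : orderedExp A u u = 1 := by
  unfold orderedExp
  rw [tsum_eq_single 0]
  · rfl
  · intro n hn
    obtain ⟨n, rfl⟩ := Nat.exists_eq_succ_of_ne_zero hn
    ext i j
    simp [iteratedIntegral, matIntegral]

/-- The Peano-Baker series solves the linear equation. -/
lemma matPrimitiveOn_orderedExp (h : u ≤ t) (hA : MatIntegrableOn u t A) :
    MatPrimitiveOn u t (orderedExp A u) fun s => A s * orderedExp A u s := by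
  have hint := hA.mul_continuousOn h (continuousOn_orderedExp h hA)
  intro i j
  refine ⟨h, hint i j, fun s hs => ?_⟩
  rw [orderedExp_self]
  have h1 := hasSum_iteratedIntegral h hA hs i j
  rw [← hasSum_nat_add_iff' 1] at h1
  have hIcc : Icc u s ⊆ Icc u t := Icc_subset_Icc le_rfl hs.2
  have h2 : HasSum (fun n => ∫ r in u..s, (A r * iteratedIntegral A u n r) i j)
      (∫ r in u..s, (A r * orderedExp A u r) i j) := by
    refine intervalIntegral.hasSum_integral_of_dominated_convergence
      (fun n r => entrySum (A r) * (d * (d * ((∫ r in u..t, entrySum (A r)) ^ n / n.factorial))))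
      (fun n => ?_) (fun n => ?_) ?_ ?_ ?_
    · have := (hA.mul_continuousOn h (continuousOn_iteratedIntegral h hA n)).mono le_rfl hs.1 hs.2
      exact (this i j).aestronglyMeasurable_restrict_uIoc
    · refine Eventually.of_forall fun r hr => ?_
      rw [uIoc_of_le hs.1] at hr
      rw [Matrix.mul_apply]
      refine (norm_sum_le _ _).trans ?_
      have hb : ∀ k ∈ (Finset.univ : Finset (Fin d)),
          ‖A r i k * iteratedIntegral A u n r k j‖ ≤ entrySum (A r) *
            (d * ((∫ r in u..t, entrySum (A r)) ^ n / n.factorial)) := fun k _ => by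
        rw [norm_mul]
        exact mul_le_mul (abs_le_entrySum _ _ _)
          (abs_iteratedIntegral_le h hA n (hIcc ⟨hr.1.le, hr.2⟩) k j) (norm_nonneg _)
          (entrySum_nonneg _)
      refine (Finset.sum_le_sum hb).trans_eq ?_
      simp
      ring
    · refine Eventually.of_forall fun r _ => ?_
      exact ((summable_iteratedIntegral_bound _ _).mul_left _).mul_left _
    · simp_rw [tsum_mul_left]
      exact (hA.mono le_rfl hs.1 hs.2).intervalIntegrable_entrySum.mul_const _
    · refine Eventually.of_forall fun r hr => ?_
      rw [uIoc_of_le hs.1] at hr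
      simp only [Matrix.mul_apply]
      exact hasSum_sum fun k _ =>
        (hasSum_iteratedIntegral h hA (hIcc ⟨hr.1.le, hr.2⟩) k j).mul_left _
  have h3 := h1.unique h2
  simp only [Finset.sum_range_one] at h3
  rw [← h3]
  simp [iteratedIntegral]

/-- A fundamental solution `M' = A M` of a linear equation together with its inverse, which solves
the adjoint equation `J' = -J A`. -/
structure IsFundamentalOn (u t : ℝ) (A M J : ℝ → Matrix (Fin d) (Fin d) ℝ) : Prop where
  fwd : MatPrimitiveOn u t M fun s => A s * M s
  bwd : MatPrimitiveOn u t J fun s => -(J s * A s)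
  fwd_init : M u = 1
  bwd_init : J u = 1
  inv_mul : ∀ s ∈ Icc u t, J s * M s = 1
  mul_inv : ∀ s ∈ Icc u t, M s * J s = 1

lemma exists_isFundamentalOn (h : u ≤ t) (hA : MatIntegrableOn u t A) :
    ∃ J, IsFundamentalOn u t A (orderedExp A u) J := by
  have hM := matPrimitiveOn_orderedExp h hA
  have hJ : MatPrimitiveOn u t (fun s => (orderedExp (fun r => -(A r)ᵀ) u s)ᵀ)
      fun s => -((orderedExp (fun r => -(A r)ᵀ) u s)ᵀ * A s) :=
    (matPrimitiveOn_orderedExp h hA.transpose.neg).transpose.congr (fun _ _ => rfl)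
      fun s _ => by simp
  have hJM : ∀ s ∈ Icc u t, (orderedExp (fun r => -(A r)ᵀ) u s)ᵀ * orderedExp A u s = 1 := by
    intro s hs
    rw [(hJ.mul h hM).eq_of_deriv_eq_zero (fun r _ => by noncomm_ring) hs]
    simp [orderedExp_self]
  exact ⟨_, hM, hJ, orderedExp_self _ _, by simp [orderedExp_self], hJM, fun s hs =>
    mul_eq_one_comm.1 (hJM s hs)⟩

/-- Time-ordered exponentials from an intermediate time are transition matrices. -/
lemma IsFundamentalOn.orderedExp_eq {M J : ℝ → Matrix (Fin d) (Fin d) ℝ}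
    (hM : IsFundamentalOn u t A M J) (hA : MatIntegrableOn u t A) {v s : ℝ} (huv : u ≤ v)
    (hvs : v ≤ s) (hst : s ≤ t) : orderedExp A v s = M s * J v := by
  have hs : s ∈ Icc u t := ⟨huv.trans hvs, hst⟩
  have h1 := matPrimitiveOn_orderedExp hvs (hA.mono huv hvs hst)
  have h2 := ((hM.bwd.restrict huv hvs hst).mul hvs h1).eq_of_deriv_eq_zero
    (fun r _ => by noncomm_ring) (right_mem_Icc.2 hvs)
  rw [orderedExp_self, mul_one] at h2
  rw [← h2, ← mul_assoc, hM.mul_inv s hs, one_mul]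

end PeanoBaker

/-! ### Integrability of the observation information -/

section obsInfo

lemma aemeasurable_det {α : Type*} [MeasurableSpace α] {μ : Measure α} {d : ℕ}
    {M : α → Matrix (Fin d) (Fin d) ℝ} (hM : ∀ i j, AEMeasurable (fun r => M r i j) μ) :
    AEMeasurable (fun r => (M r).det) μ := by
  simp only [Matrix.det_apply]
  refine Finset.aemeasurable_fun_sum _ fun p _ => ?_
  exact (Finset.aemeasurable_fun_prod _ fun i _ => hM (p i) i).const_smul _

lemma aemeasurable_inv {α : Type*} [MeasurableSpace α] {μ : Measure α} {d : ℕ}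
    {M : α → Matrix (Fin d) (Fin d) ℝ} (hM : ∀ i j, AEMeasurable (fun r => M r i j) μ)
    (i j : Fin d) : AEMeasurable (fun r => (M r)⁻¹ i j) μ := by
  simp only [Matrix.inv_def, Ring.inverse_eq_inv', Matrix.smul_apply, Matrix.adjugate_apply,
    smul_eq_mul]
  refine (aemeasurable_det hM).inv.mul (aemeasurable_det fun k l => ?_)
  simp only [Matrix.updateRow_apply]
  split_ifs
  · exact aemeasurable_const
  · exact hM k l

/-- If the spectrum of a symmetric matrix lies above `C > 0`, then the entries of its inverse are
bounded by `1 / C`. -/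
lemma abs_inv_apply_le {d : ℕ} {M : Matrix (Fin d) (Fin d) ℝ} (hM : M.IsHermitian) {C : ℝ}
    (hC : 0 < C) (hspec : ∀ l ∈ spectrum ℝ M, C < l) (i j : Fin d) : |M⁻¹ i j| ≤ C⁻¹ := by
  have hunit : IsUnit M := by
    by_contra h
    exact absurd (hspec 0 (spectrum.zero_mem ℝ h)) (not_lt.2 hC.le)
  have hle : (M - algebraMap ℝ _ C).PosSemidef :=
    Matrix.le_iff.1 ((algebraMap_le_iff_le_spectrum (r := C) (a := M) hM).2
      fun l hl => (hspec l hl).le)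
  -- The column `x = M⁻¹ e_j` satisfies `C |x|² ≤ xᵀ M x = x_j`.
  set x : Fin d → ℝ := fun k => M⁻¹ k j with hx
  have hMx : M *ᵥ x = Pi.single j 1 := by
    have h1 : M * M⁻¹ = 1 := Matrix.mul_nonsing_inv _ ((Matrix.isUnit_iff_isUnit_det _).1 hunit)
    ext k
    have := congrFun (congrFun h1 k) j
    rw [Matrix.mul_apply] at this
    simp only [Matrix.mulVec, dotProduct, hx, this, Matrix.one_apply, Pi.single_apply]
  have hq := hle.dotProduct_mulVec_nonneg x
  have hcoef : C * (x ⬝ᵥ x) ≤ x j := by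
    rw [Matrix.sub_mulVec, hMx, Algebra.algebraMap_eq_smul_one, Matrix.smul_mulVec,
      Matrix.one_mulVec] at hq
    simp only [star_trivial, dotProduct_sub, dotProduct_smul, dotProduct_single, mul_one,
      smul_eq_mul] at hq
    linarith
  have hsq : ∀ k, x k ^ 2 ≤ x ⬝ᵥ x := fun k => by
    rw [pow_two]
    exact Finset.single_le_sum (f := fun k => x k * x k) (fun k _ => mul_self_nonneg _)
      (Finset.mem_univ k)
  have hj : C * x j ≤ 1 := by
    by_contra! h
    have := hsq j
    have hpos : 0 < x j := (mul_pos_iff_of_pos_left hC).1 (lt_trans one_pos h)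
    nlinarith
  have hi : x i ^ 2 ≤ C⁻¹ ^ 2 := by
    rw [inv_pow, ← one_div, le_div_iff₀ (by positivity)]
    have := hsq i
    nlinarith
  exact abs_le_of_sq_le_sq hi (by positivity)

variable {d₁ d₂ m₁ m₂ : ℕ} {a : ℝ → Matrix (Fin d₁) (Fin d₁) ℝ}
  {b : ℝ → Matrix (Fin d₁) (Fin m₁) ℝ} {c : ℝ → Matrix (Fin d₂) (Fin d₁) ℝ}
  {σ : ℝ → Matrix (Fin d₂) (Fin m₂) ℝ}

lemma obsInfo_transpose (r : ℝ) : (obsInfo c σ r)ᵀ = obsInfo c σ r := by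
  simp [obsInfo, Matrix.transpose_mul, Matrix.transpose_nonsing_inv, Matrix.mul_assoc]

lemma intervalIntegrable_of_integrableOn_Icc {f : ℝ → ℝ} {u t : ℝ} (h : u ≤ t)
    (hf : IntegrableOn f (Icc u t)) : IntervalIntegrable f volume u t :=
  (intervalIntegrable_iff_integrableOn_Icc_of_le h).2 hf

lemma CoefficientAssumptions.matIntegrableOn_a (hcoef : CoefficientAssumptions a b c σ) {t : ℝ}
    (ht : 0 ≤ t) : MatIntegrableOn 0 t a := fun i j =>
  intervalIntegrable_of_integrableOn_Icc ht (hcoef.integrable_a t ht i j)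

lemma CoefficientAssumptions.matIntegrableOn_mul_transpose_b
    (hcoef : CoefficientAssumptions a b c σ) {t : ℝ} (ht : 0 ≤ t) :
    MatIntegrableOn 0 t fun r => b r * (b r)ᵀ := fun i j => by
  refine intervalIntegrable_of_integrableOn_Icc ht ?_
  simp only [Matrix.mul_apply, Matrix.transpose_apply]
  exact integrable_finsetSum _ fun k _ =>
    (hcoef.memLp_b t ht i k).integrable_mul (hcoef.memLp_b t ht j k)

lemma CoefficientAssumptions.matIntegrableOn_obsInfo (hcoef : CoefficientAssumptions a b c σ)
    {t : ℝ} (ht : 0 ≤ t) : MatIntegrableOn 0 t (obsInfo c σ) := fun i j => by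
  refine intervalIntegrable_of_integrableOn_Icc ht ?_
  obtain ⟨C, hC, hspec⟩ := hcoef.nondegenerate
  have hG : ∀ r, obsInfo c σ r i j =
      ∑ l, ∑ k, c r k i * (σ r * (σ r)ᵀ)⁻¹ k l * c r l j := fun r => by
    rw [obsInfo, Matrix.mul_apply]
    simp only [Matrix.mul_apply (M := (c r)ᵀ), Matrix.transpose_apply, Finset.sum_mul]
  simp only [hG]
  refine integrable_finsetSum _ fun l _ => integrable_finsetSum _ fun k _ => ?_
  have h1 := (hcoef.memLp_c t ht k i).integrable_mul (hcoef.memLp_c t ht l j)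
  have hmeas : AEMeasurable (fun r => (σ r * (σ r)ᵀ)⁻¹ k l) (volume.restrict (Icc 0 t)) := by
    refine aemeasurable_inv (fun p q => ?_) k l
    simp only [Matrix.mul_apply, Matrix.transpose_apply]
    exact Finset.aemeasurable_fun_sum _ fun s _ =>
      (hcoef.memLp_σ t ht p s).aestronglyMeasurable.aemeasurable.mul
        (hcoef.memLp_σ t ht q s).aestronglyMeasurable.aemeasurable
  have hbdd : ∀ᵐ r ∂(volume.restrict (Icc 0 t)), ‖(σ r * (σ r)ᵀ)⁻¹ k l‖ ≤ C⁻¹ := by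
    filter_upwards [ae_restrict_mem measurableSet_Icc] with r hr
    have hH : (σ r * (σ r)ᵀ).IsHermitian := by
      simpa using Matrix.isHermitian_mul_conjTranspose_self (σ r)
    exact abs_inv_apply_le hH hC (hspec r hr.1) k l
  refine (h1.bdd_mul hmeas.aestronglyMeasurable hbdd).congr (Eventually.of_forall fun r => ?_)
  simp only [Pi.mul_apply]
  ring

end obsInfo

/-! ### The forward and the backward Riccati equation -/

section Riccati

variable {d : ℕ} {t : ℝ} {a B G γ φ Ψ Θ M J N : ℝ → Matrix (Fin d) (Fin d) ℝ}

/-- The smoothing gramian `N(s) = ∫_s^t Ψ(v, s)ᵀ G(v) Ψ(v, s) dv`, written through a fundamental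
solution `Ψ` of the filter equation on `[0, t]` and its inverse `Θ`. -/
noncomputable def gramian (t : ℝ) (G Ψ Θ : ℝ → Matrix (Fin d) (Fin d) ℝ) (s : ℝ) :
    Matrix (Fin d) (Fin d) ℝ :=
  (Θ s)ᵀ * matIntegral (fun v => (Ψ v)ᵀ * G v * Ψ v) s t * Θ s

lemma matIntegral_self {d e : ℕ} (F : ℝ → Matrix (Fin d) (Fin e) ℝ) (u : ℝ) :
    matIntegral F u u = 0 := by
  ext i j
  simp [matIntegral]

lemma matIntegral_neg {d e : ℕ} (F : ℝ → Matrix (Fin d) (Fin e) ℝ) (u s : ℝ) :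
    matIntegral (fun r => -F r) u s = -matIntegral F u s := by
  ext i j
  simp [matIntegral]

lemma MatIntegrableOn.matIntegral_add {d e : ℕ} {F : ℝ → Matrix (Fin d) (Fin e) ℝ} {t : ℝ}
    (hF : MatIntegrableOn 0 t F) {s : ℝ} (hs : s ∈ Icc 0 t) :
    matIntegral F 0 s + matIntegral F s t = matIntegral F 0 t := by
  ext i j
  exact intervalIntegral.integral_add_adjacent_intervals (hF.mono le_rfl hs.1 hs.2 i j)
    (hF.mono hs.1 hs.2 le_rfl i j)

/-- A function `s ↦ ∫_s^t F` has derivative `-F`. -/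
lemma MatIntegrableOn.matPrimitiveOn_left {d e : ℕ} {F : ℝ → Matrix (Fin d) (Fin e) ℝ} {t : ℝ}
    (ht : 0 ≤ t) (hF : MatIntegrableOn 0 t F) :
    MatPrimitiveOn 0 t (fun s => matIntegral F s t) fun s => -F s := by
  refine (hF.neg.matPrimitiveOn ht (matIntegral F 0 t)).congr (fun s hs => ?_) fun _ _ => rfl
  rw [matIntegral_neg, ← hF.matIntegral_add hs]
  abel

/-- The gramian solves the Lyapunov equation `N' = -G - Fᵀ N - N F`, `N(t) = 0`. -/
lemma IsFundamentalOn.matPrimitiveOn_gramian {F : ℝ → Matrix (Fin d) (Fin d) ℝ} (ht : 0 ≤ t)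
    (hΨ : IsFundamentalOn 0 t F Ψ Θ) (hG : MatIntegrableOn 0 t G) :
    MatPrimitiveOn 0 t (gramian t G Ψ Θ) fun s =>
      -G s - (F s)ᵀ * gramian t G Ψ Θ s - gramian t G Ψ Θ s * F s := by
  have hΨc := hΨ.fwd.continuousOn
  have hΨt := continuous_id.matrix_transpose.comp_continuousOn hΨc
  have hR := ((hG.continuousOn_mul ht hΨt).mul_continuousOn ht hΨc).matPrimitiveOn_left ht
  refine ((hΨ.bwd.transpose.mul ht hR).mul ht hΨ.bwd).congr (fun _ _ => rfl) fun s hs => ?_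
  have h1 := hΨ.mul_inv s hs
  have h2 : (Θ s)ᵀ * (Ψ s)ᵀ = 1 := by rw [← Matrix.transpose_mul, h1, Matrix.transpose_one]
  have h3 : (Θ s)ᵀ * ((Ψ s)ᵀ * G s * Ψ s) * Θ s = G s := by
    calc _ = ((Θ s)ᵀ * (Ψ s)ᵀ) * G s * (Ψ s * Θ s) := by noncomm_ring
      _ = G s := by rw [h1, h2, one_mul, mul_one]
  rw [gramian, Matrix.transpose_neg, Matrix.transpose_mul]
  simp only [id, Function.comp]
  conv_lhs => rw [← h3]
  noncomm_ring

/-- The hypotheses shared by the Riccati lemmas: `γ` and `φ` are symmetric solutions on `[0, t]` of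
the forward and the backward Riccati equation with symmetric coefficients `B` (playing the role of
`b bᵀ`) and `G`, and `φ(t) = 0`. -/
structure RiccatiPair (t : ℝ) (a B G γ φ : ℝ → Matrix (Fin d) (Fin d) ℝ) : Prop where
  nonneg : 0 ≤ t
  forward : MatPrimitiveOn 0 t γ fun r =>
    -(γ r * G r * γ r) + a r * γ r + γ r * (a r)ᵀ + B r
  backward : MatPrimitiveOn 0 t φ fun r =>
    -(φ r * B r * φ r) - (a r)ᵀ * φ r - φ r * a r + G r
  terminal : φ t = 0
  integrable_G : MatIntegrableOn 0 t G
  transpose_B : ∀ s ∈ Icc 0 t, (B s)ᵀ = B s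
  transpose_G : ∀ s ∈ Icc 0 t, (G s)ᵀ = G s
  transpose_γ : ∀ s ∈ Icc 0 t, (γ s)ᵀ = γ s
  transpose_φ : ∀ s ∈ Icc 0 t, (φ s)ᵀ = φ s

namespace RiccatiPair

variable (h : RiccatiPair t a B G γ φ) (hΨ : IsFundamentalOn 0 t (fun r => a r - γ r * G r) Ψ Θ)
  (hM : IsFundamentalOn 0 t (fun r => a r + B r * φ r) M J)

include h hΨ hM

/-- The gramian `N` and the backward solution `φ` determine each other: `N = -(1 - φ γ)⁻¹ φ`. The
difference `W = (1 - φ γ) N + φ` solves the homogeneous equation `W' = -Aᵀ W - W F` and vanishes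
at time `t`. -/
lemma gramian_add_eq_zero {s : ℝ} (hs : s ∈ Icc 0 t) :
    (1 - φ s * γ s) * gramian t G Ψ Θ s + φ s = 0 := by
  have hN := hΨ.matPrimitiveOn_gramian h.nonneg h.integrable_G
  have hE := (MatPrimitiveOn.const h.nonneg (1 : Matrix (Fin d) (Fin d) ℝ)).sub
    (h.backward.mul h.nonneg h.forward)
  have hW := (hE.mul h.nonneg hN).add h.backward
  have hMW := (hM.fwd.transpose.mul h.nonneg hW).mul h.nonneg hΨ.fwd
  have hconst : ∀ r ∈ Icc 0 t, _ := fun r hr => hMW.eq_of_deriv_eq_zero (fun r hr => by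
    have h1 := h.transpose_γ r hr
    have h2 := h.transpose_φ r hr
    simp only [Matrix.transpose_mul, Matrix.transpose_add, Matrix.transpose_sub, h1, h2,
      h.transpose_G r hr, h.transpose_B r hr]
    noncomm_ring) hr
  have hT := hconst t (right_mem_Icc.2 h.nonneg)
  have h0 := hconst s hs
  rw [← hT] at h0
  have hNt : gramian t G Ψ Θ t = 0 := by simp [gramian, matIntegral_self]
  simp only [h.terminal, hNt, mul_zero, add_zero, zero_mul] at h0
  have h1 := hΨ.mul_inv s hs
  have h2 : (J s)ᵀ * (M s)ᵀ = 1 := by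
    rw [← Matrix.transpose_mul, hM.mul_inv s hs, Matrix.transpose_one]
  calc (1 - φ s * γ s) * gramian t G Ψ Θ s + φ s
      = ((J s)ᵀ * (M s)ᵀ) * ((1 - φ s * γ s) * gramian t G Ψ Θ s + φ s) * (Ψ s * Θ s) := by
        rw [h1, h2, one_mul, mul_one]
    _ = (J s)ᵀ * ((M s)ᵀ * ((1 - φ s * γ s) * gramian t G Ψ Θ s + φ s) * Ψ s) * Θ s := by
        noncomm_ring
    _ = 0 := by rw [h0, mul_zero, zero_mul]

lemma one_sub_mul_one_sub {s : ℝ} (hs : s ∈ Icc 0 t) :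
    (1 - γ s * φ s) * (1 - γ s * gramian t G Ψ Θ s) = 1 := by
  have hW := h.gramian_add_eq_zero hΨ hM hs
  calc (1 - γ s * φ s) * (1 - γ s * gramian t G Ψ Θ s)
      = 1 - γ s * ((1 - φ s * γ s) * gramian t G Ψ Θ s + φ s) := by noncomm_ring
    _ = 1 := by rw [hW, mul_zero, sub_zero]

/-- `L = 1 - γ N` intertwines the filter equation and the smoothing equation:
`L' = (a + B φ) L - L (a - γ G)`. -/
lemma matPrimitiveOn_one_sub :
    MatPrimitiveOn 0 t (fun s => 1 - γ s * gramian t G Ψ Θ s) fun s =>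
      (a s + B s * φ s) * (1 - γ s * gramian t G Ψ Θ s) -
        (1 - γ s * gramian t G Ψ Θ s) * (a s - γ s * G s) := by
  have hN := hΨ.matPrimitiveOn_gramian h.nonneg h.integrable_G
  refine ((MatPrimitiveOn.const h.nonneg (1 : Matrix (Fin d) (Fin d) ℝ)).sub
    (h.forward.mul h.nonneg hN)).congr (fun _ _ => rfl) fun s hs => ?_
  have hW := h.gramian_add_eq_zero hΨ hM hs
  rw [← sub_eq_zero]
  simp only [Matrix.transpose_mul, Matrix.transpose_sub, h.transpose_γ s hs, h.transpose_G s hs]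
  -- The two sides differ by `B W`, where `W = (1 - φ γ) N + φ` vanishes.
  refine Eq.trans (b := B s * ((1 - φ s * γ s) * gramian t G Ψ Θ s + φ s)) ?_
    (by rw [hW, mul_zero])
  noncomm_ring

/-- The transition matrices of the smoothing equation and of the filter are conjugate through
`1 - γ N`. -/
lemma transition_eq {u s : ℝ} (hu : 0 ≤ u) (hus : u ≤ s) (hst : s ≤ t) :
    M s * J u * (1 - γ u * gramian t G Ψ Θ u) =
      (1 - γ s * gramian t G Ψ Θ s) * (Ψ s * Θ u) := by
  have hL := h.matPrimitiveOn_one_sub hΨ hM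
  have hc := (hM.bwd.mul h.nonneg hL).mul h.nonneg hΨ.fwd
  have hconst : ∀ r ∈ Icc 0 t, _ := fun r hr => hc.eq_of_deriv_eq_zero
    (fun r hr => by noncomm_ring) hr
  have hs' : s ∈ Icc 0 t := ⟨hu.trans hus, hst⟩
  have hu' : u ∈ Icc 0 t := ⟨hu, hus.trans hst⟩
  have hu1 := hconst u hu'
  rw [← hconst s hs'] at hu1
  calc M s * J u * (1 - γ u * gramian t G Ψ Θ u)
      = M s * (J u * (1 - γ u * gramian t G Ψ Θ u) * Ψ u) * Θ u := by
        rw [mul_assoc (M s), mul_assoc (M s), mul_assoc _ (Ψ u), hΨ.mul_inv u hu', mul_one]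
    _ = (M s * J s) * (1 - γ s * gramian t G Ψ Θ s) * (Ψ s * Θ u) := by
        rw [hu1]
        noncomm_ring
    _ = _ := by rw [hM.mul_inv s hs', one_mul]

/-- `T = (1 - γ N) γ` solves the Lyapunov equation `T' = A T + T Aᵀ + B` with `A = a + B φ`, stated
here for `J T Jᵀ` with `J` the inverse of the fundamental solution. -/
lemma matPrimitiveOn_conj :
    MatPrimitiveOn 0 t (fun s => J s * ((1 - γ s * gramian t G Ψ Θ s) * γ s) * (J s)ᵀ)
      fun s => J s * B s * (J s)ᵀ := by
  have hL := h.matPrimitiveOn_one_sub hΨ hM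
  refine ((hM.bwd.mul h.nonneg (hL.mul h.nonneg h.forward)).mul h.nonneg
    hM.bwd.transpose).congr (fun _ _ => rfl) fun s hs => ?_
  have h1 := mul_eq_one_comm.1 (h.one_sub_mul_one_sub hΨ hM hs)
  simp only [Matrix.transpose_neg, Matrix.transpose_mul, Matrix.transpose_add,
    h.transpose_φ s hs, h.transpose_B s hs]
  have h2 : J s * B s * (J s)ᵀ =
      J s * ((1 - γ s * gramian t G Ψ Θ s) * (1 - γ s * φ s)) * B s * (J s)ᵀ := by
    rw [h1, mul_one]
  rw [h2]
  noncomm_ring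

end RiccatiPair

/-- The initial covariance matrix of the smoothing process is `(1 - γ(0) φ(0))⁻¹ γ(0)`, whenever
`1 - γ(0) φ(0)` has the inverse `L`. -/
lemma sqrt_mul_inv_mul_sqrt {S f L : Matrix (Fin d) (Fin d) ℝ} (hS : S.PosSemidef)
    (hL : (1 - S * f) * L = 1) :
    CFC.sqrt S * (1 - CFC.sqrt S * f * CFC.sqrt S)⁻¹ * CFC.sqrt S = L * S := by
  set R := CFC.sqrt S with hR
  have hRR : R * R = S := CFC.sqrt_mul_sqrt_self S (Matrix.nonneg_iff_posSemidef.2 hS)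
  have hdet : IsUnit (1 - R * f * R).det := by
    have h1 : (1 - R * f * R).det = (1 - S * f).det := by
      have := Matrix.det_one_add_mul_comm (-(R * f)) R
      rw [← hRR]
      simpa [sub_eq_add_neg, mul_assoc] using this
    rw [h1]
    exact (Matrix.isUnit_iff_isUnit_det _).1 (IsUnit.of_mul_eq_one _ hL)
  have hinv := Matrix.mul_nonsing_inv _ hdet
  have hLl := mul_eq_one_comm.1 hL
  calc R * (1 - R * f * R)⁻¹ * R
      = (L * (1 - S * f)) * R * (1 - R * f * R)⁻¹ * R := by rw [hLl, one_mul]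
    _ = L * R * ((1 - R * f * R) * (1 - R * f * R)⁻¹) * R := by
        rw [← hRR]
        noncomm_ring
    _ = L * S := by rw [hinv, mul_one, mul_assoc, hRR]

end Riccati

/-! ### Square integrable functions -/

section L2

variable {α : Type*} [MeasurableSpace α] {μ : Measure α}

lemma integral_sum_mul_sum {ι κ : Type*} (S : Finset ι) (T : Finset κ) {X : ι → α → ℝ}
    {Y : κ → α → ℝ} (hX : ∀ p ∈ S, MemLp (X p) 2 μ) (hY : ∀ q ∈ T, MemLp (Y q) 2 μ) :
    ∫ x, (∑ p ∈ S, X p x) * (∑ q ∈ T, Y q x) ∂μ = ∑ p ∈ S, ∑ q ∈ T, ∫ x, X p x * Y q x ∂μ := by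
  simp only [Finset.sum_mul_sum]
  have h : ∀ p ∈ S, ∀ q ∈ T, Integrable (fun x => X p x * Y q x) μ := fun p hp q hq =>
    (hX p hp).integrable_mul (hY q hq)
  rw [integral_finsetSum _ fun p hp => integrable_finsetSum _ (h p hp)]
  exact Finset.sum_congr rfl fun p hp => integral_finsetSum _ (h p hp)

/-- The pairing `(f, g) ↦ ∫ f g` is continuous with respect to convergence in `L²`. -/
lemma tendsto_integral_mul {f g : ℕ → α → ℝ} {F G : α → ℝ} (hf : ∀ n, MemLp (f n) 2 μ)
    (hg : ∀ n, MemLp (g n) 2 μ) (hF : MemLp F 2 μ) (hG : MemLp G 2 μ)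
    (hfF : Tendsto (fun n => eLpNorm (fun x => f n x - F x) 2 μ) atTop (𝓝 0))
    (hgG : Tendsto (fun n => eLpNorm (fun x => g n x - G x) 2 μ) atTop (𝓝 0)) :
    Tendsto (fun n => ∫ x, f n x * g n x ∂μ) atTop (𝓝 (∫ x, F x * G x ∂μ)) := by
  have h1 := (Lp.tendsto_Lp_iff_tendsto_eLpNorm'' f hf F hF).2 hfF
  have h2 := (Lp.tendsto_Lp_iff_tendsto_eLpNorm'' g hg G hG).2 hgG
  have key : ∀ {p q : α → ℝ} (hp : MemLp p 2 μ) (hq : MemLp q 2 μ),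
      inner ℝ (hp.toLp p) (hq.toLp q) = ∫ x, p x * q x ∂μ := fun {p q} hp hq => by
    rw [L2.inner_def]
    refine integral_congr_ae ?_
    filter_upwards [hp.coeFn_toLp, hq.coeFn_toLp] with x h1 h2
    rw [h1, h2]
    simp [mul_comm]
  have h3 := Tendsto.inner (𝕜 := ℝ) h1 h2
  simpa only [key] using h3

/-- A measurable limit in `L²` of square integrable functions is square integrable: one term of the
sequence is at finite `L²` distance. Measurability has to be assumed, since `eLpNorm` is a lower
integral on functions that are not measurable. -/
lemma memLp_of_tendsto_eLpNorm {f : ℕ → α → ℝ} {F : α → ℝ} (hf : ∀ n, MemLp (f n) 2 μ)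
    (hF : AEMeasurable F μ)
    (hfF : Tendsto (fun n => eLpNorm (fun x => f n x - F x) 2 μ) atTop (𝓝 0)) : MemLp F 2 μ := by
  obtain ⟨n, hn⟩ := (hfF.eventually (gt_mem_nhds ENNReal.zero_lt_top)).exists
  have h : MemLp (fun x => f n x - F x) 2 μ :=
    ⟨(hf n).aestronglyMeasurable.sub hF.aestronglyMeasurable, hn⟩
  have h1 := (hf n).sub h
  have h2 : (f n - fun x => f n x - F x) = F := by
    ext x
    simp
  rwa [h2] at h1

end L2

/-! ### The Itô isometry -/

section Ito

variable {Ω : Type*} [MeasurableSpace Ω] {P : Measure Ω} {d e m : ℕ}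
  {V : ℝ≥0 → Ω → Fin m → ℝ}

lemma IsBrownianVec.memLp (hV : IsBrownianVec P V) (r : ℝ≥0) (i : Fin m) :
    MemLp (fun ω => V r ω i) 2 P :=
  ((hV.isBrownian i).hasLaw_eval r).hasGaussianLaw.memLp_two

lemma IsBrownianVec.memLp_incr (hV : IsBrownianVec P V) (r s : ℝ≥0) (i : Fin m) :
    MemLp (fun ω => V r ω i - V s ω i) 2 P :=
  (hV.memLp r i).sub (hV.memLp s i)

lemma IsBrownianVec.integral_eval (hV : IsBrownianVec P V) (r : ℝ≥0) (i : Fin m) :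
    ∫ ω, V r ω i ∂P = 0 :=
  (hV.isBrownian i).integral_eval r

lemma IsBrownianVec.integral_mul [IsProbabilityMeasure P] (hV : IsBrownianVec P V) (r s : ℝ≥0)
    (i j : Fin m) :
    ∫ ω, V r ω i * V s ω j ∂P = if i = j then (min r s : ℝ) else 0 := by
  split_ifs with hij
  · subst hij
    have h1 := (hV.isBrownian i).covariance_eval r s
    rw [covariance_eq_sub (hV.memLp r i) (hV.memLp s i), hV.integral_eval, zero_mul, sub_zero] at h1
    simpa using h1
  · have h1 : IndepFun (fun ω => V r ω i) (fun ω => V s ω j) P :=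
      (hV.indep.indepFun hij).comp (measurable_pi_apply r) (measurable_pi_apply s)
    have h2 := h1.integral_mul_eq_mul_integral (hV.memLp r i).aestronglyMeasurable
      (hV.memLp s j).aestronglyMeasurable
    rw [hV.integral_eval, zero_mul] at h2
    simpa using h2

lemma integral_indicator_Ioc_mul_indicator_Ioc {p p' q q' : ℝ} (hp : p ≤ p') (hq : q ≤ q') :
    ∫ r, (Ioc p p').indicator (fun _ => (1 : ℝ)) r * (Ioc q q').indicator (fun _ => (1 : ℝ)) r =
      min p' q' - min p' q - (min p q' - min p q) := by
  have h : (fun r => (Ioc p p').indicator (fun _ => (1 : ℝ)) r *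
      (Ioc q q').indicator (fun _ => (1 : ℝ)) r) =
      (Ioc p p' ∩ Ioc q q').indicator (fun _ => (1 : ℝ)) := by
    ext r
    rw [← Set.inter_indicator_mul]
    simp
  rw [h, integral_indicator (measurableSet_Ioc.inter measurableSet_Ioc), Ioc_inter_Ioc]
  simp only [integral_const, MeasurableSet.univ, measureReal_restrict_apply, univ_inter,
    Real.volume_real_Ioc, smul_eq_mul, mul_one]
  rcases le_total p' q' with h1 | h1 <;> rcases le_total p q with h2 | h2 <;>
    rcases le_total p' q with h3 | h3 <;> rcases le_total p q' with h4 | h4 <;>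
    simp only [min_eq_left, min_eq_right, max_eq_left, max_eq_right, h1, h2, h3, h4,
      sub_nonneg, sub_nonpos] <;> first | linarith | skip
  all_goals simp only [max_def]; split_ifs <;> linarith

lemma IsBrownianVec.integral_incr_mul_incr [IsProbabilityMeasure P] (hV : IsBrownianVec P V)
    {p p' q q' : ℝ≥0}
    (hp : p ≤ p') (hq : q ≤ q') (i j : Fin m) :
    ∫ ω, (V p' ω i - V p ω i) * (V q' ω j - V q ω j) ∂P = if i = j then
      ∫ r, (Ioc (p : ℝ) p').indicator (fun _ => (1 : ℝ)) r *
        (Ioc (q : ℝ) q').indicator (fun _ => (1 : ℝ)) r else 0 := by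
  have h : ∀ r s, Integrable (fun ω => V r ω i * V s ω j) P := fun r s =>
    (hV.memLp r i).integrable_mul (hV.memLp s j)
  simp only [sub_mul, mul_sub]
  have h' : ∀ r r' s, Integrable (fun ω => V r ω i * V s ω j - V r' ω i * V s ω j) P :=
    fun r r' s => (h r s).sub (h r' s)
  rw [integral_sub (h' _ _ _) (h' _ _ _), integral_sub (h _ _) (h _ _),
    integral_sub (h _ _) (h _ _)]
  simp only [hV.integral_mul]
  split_ifs
  · rw [integral_indicator_Ioc_mul_indicator_Ioc (NNReal.coe_le_coe.2 hp) (NNReal.coe_le_coe.2 hq)]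
    ring
  · simp

namespace StepFun

lemma eval_apply (f : StepFun d m) (r : ℝ) (i : Fin d) (l : Fin m) :
    f.eval r i l = ∑ k ∈ Finset.range f.N,
      f.val k i l * (Ioc (f.node k : ℝ) (f.node (k + 1))).indicator (fun _ => (1 : ℝ)) r := by
  rw [eval, Matrix.sum_apply]
  refine Finset.sum_congr rfl fun k _ => ?_
  by_cases hr : r ∈ Ioc (f.node k : ℝ) (f.node (k + 1)) <;> simp [hr]

omit [MeasurableSpace Ω] in
lemma stochInt_apply (f : StepFun d m) (ω : Ω) (i : Fin d) :
    f.stochInt V ω i = ∑ p ∈ Finset.range f.N ×ˢ (Finset.univ : Finset (Fin m)),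
      f.val p.1 i p.2 * (V (f.node (p.1 + 1)) ω p.2 - V (f.node p.1) ω p.2) := by
  rw [stochInt, Finset.sum_apply, Finset.sum_product]
  rfl

lemma memLp_indicator (f : StepFun d m) (k : ℕ) : MemLp
    ((Ioc (f.node k : ℝ) (f.node (k + 1))).indicator (fun _ => (1 : ℝ))) 2 volume :=
  memLp_indicator_const _ measurableSet_Ioc _ (Or.inr (by simp))

lemma memLp_eval (f : StepFun d m) (i : Fin d) (l : Fin m) :
    MemLp (fun r => f.eval r i l) 2 volume := by
  simp only [eval_apply]
  exact memLp_finsetSum _ fun k _ => (f.memLp_indicator k).const_mul _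

lemma memLp_stochInt (hV : IsBrownianVec P V) (f : StepFun d m) (i : Fin d) :
    MemLp (fun ω => f.stochInt V ω i) 2 P := by
  simp only [stochInt_apply]
  exact memLp_finsetSum _ fun k _ => (hV.memLp_incr _ _ _).const_mul _

lemma integral_mul_stochInt (hV : IsBrownianVec P V) (f : StepFun d m) (i : Fin d) {Z : Ω → ℝ}
    (hZ : MemLp Z 2 P) (hZV : IndepFun Z (fun ω (r : ℝ≥0) => V r ω) P) :
    ∫ ω, Z ω * f.stochInt V ω i ∂P = 0 := by
  have h : ∀ r l, ∫ ω, Z ω * V r ω l ∂P = 0 := fun r l => by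
    have h1 : IndepFun Z (fun ω => V r ω l) P :=
      hZV.comp (φ := id) (ψ := fun v : ℝ≥0 → Fin m → ℝ => v r l) measurable_id
        ((measurable_pi_apply l).comp (measurable_pi_apply r))
    have h2 := h1.integral_mul_eq_mul_integral hZ.aestronglyMeasurable
      (hV.memLp r l).aestronglyMeasurable
    rw [hV.integral_eval, mul_zero] at h2
    simpa using h2
  have hi : ∀ r l, Integrable (fun ω => Z ω * V r ω l) P := fun r l =>
    hZ.integrable_mul (hV.memLp r l)
  have hincr : ∀ r s l, ∫ ω, Z ω * (V r ω l - V s ω l) ∂P = 0 := fun r s l => by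
    simp only [mul_sub]
    rw [integral_sub (hi _ _) (hi _ _), h, h, sub_zero]
  have h1 := integral_sum_mul_sum {()} (Finset.range f.N ×ˢ (Finset.univ : Finset (Fin m)))
    (X := fun _ => Z) (Y := fun p ω =>
      f.val p.1 i p.2 * (V (f.node (p.1 + 1)) ω p.2 - V (f.node p.1) ω p.2)) (fun _ _ => hZ)
    fun p _ => (hV.memLp_incr _ _ _).const_mul _
  simp only [Finset.sum_singleton] at h1
  simp only [stochInt_apply]
  rw [h1]
  refine Finset.sum_eq_zero fun p _ => ?_
  simp only [mul_left_comm (Z _), integral_const_mul, hincr, mul_zero]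

/-- The Itô isometry for step functions. -/
lemma integral_stochInt_mul_stochInt [IsProbabilityMeasure P] (hV : IsBrownianVec P V)
    (f : StepFun d m) (g : StepFun e m) (i : Fin d) (j : Fin e) :
    ∫ ω, f.stochInt V ω i * g.stochInt V ω j ∂P = ∑ l, ∫ r, f.eval r i l * g.eval r j l := by
  simp only [stochInt_apply, eval_apply]
  rw [integral_sum_mul_sum _ _
    (fun p _ => (hV.memLp_incr _ _ _).const_mul _)
    fun p _ => (hV.memLp_incr _ _ _).const_mul _]
  have h1 : ∀ l, _ := fun l => integral_sum_mul_sum (Finset.range f.N) (Finset.range g.N)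
    (X := fun k r => f.val k i l *
      (Ioc (f.node k : ℝ) (f.node (k + 1))).indicator (fun _ => (1 : ℝ)) r)
    (Y := fun k r => g.val k j l *
      (Ioc (g.node k : ℝ) (g.node (k + 1))).indicator (fun _ => (1 : ℝ)) r) (μ := volume)
    (fun k _ => (f.memLp_indicator k).const_mul _) fun k _ => (g.memLp_indicator k).const_mul _
  simp only [h1, mul_mul_mul_comm, integral_const_mul]
  have h2 : ∀ (k k' : ℕ) (l l' : Fin m),
      ∫ ω, f.val k i l * (V (f.node (k + 1)) ω l - V (f.node k) ω l) *
        (g.val k' j l' * (V (g.node (k' + 1)) ω l' - V (g.node k') ω l')) ∂P =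
      f.val k i l * g.val k' j l' * if l = l' then
        ∫ r, (Ioc (f.node k : ℝ) (f.node (k + 1))).indicator (fun _ => (1 : ℝ)) r *
          (Ioc (g.node k' : ℝ) (g.node (k' + 1))).indicator (fun _ => (1 : ℝ)) r else 0 := by
    intro k k' l l'
    rw [← hV.integral_incr_mul_incr (f.mono k.le_succ) (g.mono k'.le_succ) l l',
      ← integral_const_mul]
    exact integral_congr_ae (Eventually.of_forall fun ω => mul_mul_mul_comm _ _ _ _)
  simp only [h2, Finset.sum_product]
  rw [Finset.sum_comm]
  refine Finset.sum_congr rfl fun l _ => Finset.sum_congr rfl fun k _ =>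
    Finset.sum_congr rfl fun k' _ => ?_
  simp

lemma eval_eq_zero (f : StepFun d m) {s : ℝ} (hs : (f.node f.N : ℝ) ≤ s) {r : ℝ}
    (hr : r ∉ Icc 0 s) : f.eval r = 0 := by
  refine Finset.sum_eq_zero fun k hk => indicator_of_notMem (fun hrk => hr ?_) _
  have h1 : (f.node (k + 1) : ℝ) ≤ f.node f.N :=
    NNReal.coe_le_coe.2 (f.mono (Finset.mem_range.1 hk))
  exact ⟨(f.node k).2.trans hrk.1.le, hrk.2.trans (h1.trans hs)⟩

end StepFun

namespace IsStochInt

variable {b : ℝ → Matrix (Fin d) (Fin m) ℝ} {b' : ℝ → Matrix (Fin e) (Fin m) ℝ} {s u : ℝ}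
  {I : Ω → Fin d → ℝ} {I' : Ω → Fin e → ℝ}

lemma tendsto_apply {f : ℕ → StepFun d m}
    (h : Tendsto (fun n => eLpNorm (fun ω => (f n).stochInt V ω - I ω) 2 P) atTop (𝓝 0))
    (i : Fin d) :
    Tendsto (fun n => eLpNorm (fun ω => (f n).stochInt V ω i - I ω i) 2 P) atTop (𝓝 0) := by
  refine tendsto_of_tendsto_of_tendsto_of_le_of_le tendsto_const_nhds h
    (fun n => zero_le) fun n => eLpNorm_mono fun ω => ?_
  exact norm_le_pi_norm ((f n).stochInt V ω - I ω) i

lemma memLp (hI : IsStochInt P V b s I) (hV : IsBrownianVec P V) {i : Fin d}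
    (hm : AEMeasurable (fun ω => I ω i) P) : MemLp (fun ω => I ω i) 2 P := by
  obtain ⟨f, -, -, h⟩ := hI
  exact memLp_of_tendsto_eLpNorm (fun n => (f n).memLp_stochInt hV i) hm (tendsto_apply h i)

lemma integral_mul (hI : IsStochInt P V b s I) (hV : IsBrownianVec P V) {i : Fin d}
    (hm : AEMeasurable (fun ω => I ω i) P) {Z : Ω → ℝ} (hZ : MemLp Z 2 P)
    (hZV : IndepFun Z (fun ω (r : ℝ≥0) => V r ω) P) : ∫ ω, Z ω * I ω i ∂P = 0 := by
  have hL := hI.memLp hV hm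
  obtain ⟨f, -, -, h⟩ := hI
  have := tendsto_integral_mul (fun _ => hZ) (fun n => (f n).memLp_stochInt hV i) hZ hL
    (by simp) (tendsto_apply h i)
  simp only [(f _).integral_mul_stochInt hV i hZ hZV] at this
  exact tendsto_nhds_unique this tendsto_const_nhds

/-- The Itô isometry. -/
lemma integral_mul_integral [IsProbabilityMeasure P] (hI : IsStochInt P V b s I)
    (hI' : IsStochInt P V b' u I')
    (hV : IsBrownianVec P V) {i : Fin d} {j : Fin e}
    (hm : AEMeasurable (fun ω => I ω i) P) (hm' : AEMeasurable (fun ω => I' ω j) P)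
    (hb : ∀ l, MemLp (fun r => b r i l) 2 (volume.restrict (Icc 0 s)))
    (hb' : ∀ l, MemLp (fun r => b' r j l) 2 (volume.restrict (Icc 0 u))) :
    ∫ ω, I ω i * I' ω j ∂P = ∑ l, ∫ r in Icc 0 (min s u), b r i l * b' r j l := by
  have hL := hI.memLp hV hm
  have hL' := hI'.memLp hV hm'
  obtain ⟨f, hfs, hfb, hf⟩ := hI
  obtain ⟨g, hgs, hgb, hg⟩ := hI'
  have h1 := tendsto_integral_mul (fun n => (f n).memLp_stochInt hV i)
    (fun n => (g n).memLp_stochInt hV j) hL hL' (tendsto_apply hf i) (tendsto_apply hg j)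
  refine tendsto_nhds_unique h1 ?_
  simp only [StepFun.integral_stochInt_mul_stochInt hV]
  refine tendsto_finsetSum _ fun l _ => ?_
  have hs : volume.restrict (Icc 0 (min s u)) ≤ volume.restrict (Icc 0 s) :=
    Measure.restrict_mono (Icc_subset_Icc le_rfl (min_le_left _ _)) le_rfl
  have hu : volume.restrict (Icc 0 (min s u)) ≤ volume.restrict (Icc 0 u) :=
    Measure.restrict_mono (Icc_subset_Icc le_rfl (min_le_right _ _)) le_rfl
  have h2 : ∀ n, ∫ r, (f n).eval r i l * (g n).eval r j l =
      ∫ r in Icc 0 (min s u), (f n).eval r i l * (g n).eval r j l := fun n => by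
    refine (setIntegral_eq_integral_of_forall_compl_eq_zero fun r hr => ?_).symm
    rw [mem_Icc, le_min_iff] at hr
    by_cases hrs : r ∈ Icc 0 s
    · have hru : r ∉ Icc 0 u := fun h => hr ⟨h.1, hrs.2, h.2⟩
      simp [(g n).eval_eq_zero (hgs n) hru]
    · simp [(f n).eval_eq_zero (hfs n) hrs]
  simp only [h2]
  refine tendsto_integral_mul (fun n => ((f n).memLp_eval i l).restrict _)
    (fun n => ((g n).memLp_eval j l).restrict _) ((hb l).mono_measure hs)
    ((hb' l).mono_measure hu) ?_ ?_
  · exact tendsto_of_tendsto_of_tendsto_of_le_of_le tendsto_const_nhds (hfb i l)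
      (fun n => zero_le) fun n => eLpNorm_mono_measure _ hs
  · exact tendsto_of_tendsto_of_tendsto_of_le_of_le tendsto_const_nhds (hgb j l)
      (fun n => zero_le) fun n => eLpNorm_mono_measure _ hu

end IsStochInt

end Ito

/-! ### Time integrals of square integrable processes -/

section TimeIntegral

variable {Ω : Type*} [MeasurableSpace Ω] {P : Measure Ω} {t : ℝ} {Y : ℝ → Ω → ℝ} {β : ℝ → ℝ}

/-- A process with almost surely continuous paths agrees almost surely, at all times, with a jointly
measurable one. The latter is a limit along the grids of mesh `1 / n`, where only countably many
exceptional null sets occur. -/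
lemma exists_measurable_eq_of_continuousOn (ht : 0 ≤ t)
    (hm : ∀ s ∈ Icc 0 t, AEMeasurable (Y s) P)
    (hc : ∀ᵐ ω ∂P, ContinuousOn (fun s => Y s ω) (Icc 0 t)) :
    ∃ Z : ℝ × Ω → ℝ, Measurable Z ∧ ∀ᵐ ω ∂P, ∀ s ∈ Icc 0 t, Z (s, ω) = Y s ω := by
  have hg : ∀ n k : ℕ, min t ((k : ℝ) / n) ∈ Icc 0 t := fun n k =>
    ⟨le_min ht (by positivity), min_le_left _ _⟩
  have hex : ∀ n k : ℕ, ∃ g : Ω → ℝ, Measurable g ∧ ∀ᵐ ω ∂P, Y (min t ((k : ℝ) / n)) ω = g ω :=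
    fun n k => hm _ (hg n k)
  choose Z hZ hYZ using hex
  have hmeas : ∀ n, Measurable fun p : ℝ × Ω => Z n ⌊p.1 * n⌋₊ p.2 := fun n => by
    have h1 : Measurable fun q : ℕ × Ω => Z n q.1 q.2 :=
      measurable_from_prod_countable_right fun k => hZ n k
    have h2 : Measurable fun p : ℝ × Ω => (⌊p.1 * n⌋₊, p.2) :=
      (Nat.measurable_floor.comp (measurable_fst.mul_const _)).prodMk measurable_snd
    exact h1.comp h2
  refine ⟨fun p => limsup (fun n : ℕ => Z n ⌊p.1 * n⌋₊ p.2) atTop, Measurable.limsup hmeas, ?_⟩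
  filter_upwards [ae_all_iff.2 fun n => ae_all_iff.2 (hYZ n), hc] with ω h1 h2 s hs
  have h3 : Tendsto (fun n : ℕ => min t ((⌊s * n⌋₊ : ℝ) / n)) atTop (𝓝 s) := by
    have h4 := (tendsto_nat_floor_mul_div_atTop hs.1).comp tendsto_natCast_atTop_atTop
    have h5 := (tendsto_const_nhds (x := t)).min h4
    rwa [min_eq_right hs.2] at h5
  have h4 : Tendsto (fun n : ℕ => Y (min t ((⌊s * n⌋₊ : ℝ) / n)) ω) atTop (𝓝 (Y s ω)) :=
    (h2 s hs).tendsto.comp (tendsto_nhdsWithin_of_tendsto_nhds_of_eventually_within _ h3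
      (Eventually.of_forall fun n => hg n _))
  simp only [h1] at h4
  exact h4.limsup_eq

/-- Cauchy-Schwarz for the weight `|β|`. -/
lemma sq_integral_mul_le {s : ℝ} (hs : 0 ≤ s) {y : ℝ → ℝ} (hβ : IntervalIntegrable β volume 0 s)
    (hy : ContinuousOn y (Icc 0 s)) :
    (∫ r in 0..s, β r * y r) ^ 2 ≤ (∫ r in 0..s, |β r|) * ∫ r in 0..s, |β r| * y r ^ 2 := by
  rw [← uIcc_of_le hs] at hy
  have h1 : IntervalIntegrable (fun r => |β r| * |y r|) volume 0 s :=
    hβ.abs.mul_continuousOn hy.abs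
  have h2 : IntervalIntegrable (fun r => |β r| * y r ^ 2) volume 0 s :=
    hβ.abs.mul_continuousOn (hy.pow 2)
  have h3 : |∫ r in 0..s, β r * y r| ≤ ∫ r in 0..s, |β r| * |y r| := by
    refine (intervalIntegral.abs_integral_le_integral_abs hs).trans_eq ?_
    simp only [abs_mul]
  -- The quadratic polynomial `x ↦ ∫ |β| (|y| - x)²` is nonnegative.
  have h4 := discrim_le_zero (a := ∫ r in 0..s, |β r|) (b := -2 * ∫ r in 0..s, |β r| * |y r|)
    (c := ∫ r in 0..s, |β r| * y r ^ 2) fun x => by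
      have h5 : 0 ≤ ∫ r in 0..s, |β r| * (|y r| - x) ^ 2 :=
        intervalIntegral.integral_nonneg hs fun r _ => by positivity
      have h6 : ∀ r, |β r| * (|y r| - x) ^ 2 =
          |β r| * y r ^ 2 - (2 * x) * (|β r| * |y r|) + x * x * |β r| := fun r => by
        rw [← sq_abs (y r)]
        ring
      simp only [h6] at h5
      rw [intervalIntegral.integral_add (h2.sub (h1.const_mul _)) (hβ.abs.const_mul _),
        intervalIntegral.integral_sub h2 (h1.const_mul _), intervalIntegral.integral_const_mul,
        intervalIntegral.integral_const_mul] at h5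
      linarith
  rw [discrim] at h4
  have h5 : (∫ r in 0..s, β r * y r) ^ 2 ≤ (∫ r in 0..s, |β r| * |y r|) ^ 2 :=
    sq_le_sq' (abs_le.1 h3).1 (abs_le.1 h3).2
  linarith

lemma aemeasurable_integral_mul (hm : ∀ s ∈ Icc 0 t, AEMeasurable (Y s) P)
    (hc : ∀ᵐ ω ∂P, ContinuousOn (fun s => Y s ω) (Icc 0 t))
    (hβ : IntervalIntegrable β volume 0 t) {s : ℝ} (hs : s ∈ Icc 0 t) :
    AEMeasurable (fun ω => ∫ r in 0..s, β r * Y r ω) P := by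
  obtain ⟨Z, hZ, hZY⟩ := exists_measurable_eq_of_continuousOn (hs.1.trans hs.2) hm hc
  have hβs : AEStronglyMeasurable β (volume.restrict (Ioc 0 s)) :=
    hβ.1.aestronglyMeasurable.mono_measure
      (Measure.restrict_mono (Ioc_subset_Ioc le_rfl hs.2) le_rfl)
  have h1 : StronglyMeasurable fun q : Ω × ℝ => hβs.mk _ q.2 * Z (q.2, q.1) :=
    (hβs.stronglyMeasurable_mk.comp_measurable measurable_snd).mul
      (hZ.comp measurable_swap).stronglyMeasurable
  have h2 := (h1.integral_prod_right' (ν := volume.restrict (Ioc 0 s))).measurable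
  refine ⟨_, h2, ?_⟩
  filter_upwards [hZY] with ω hω
  rw [intervalIntegral.integral_of_le hs.1]
  refine integral_congr_ae ?_
  filter_upwards [hβs.ae_eq_mk, ae_restrict_mem measurableSet_Ioc] with r h3 h4
  rw [hω r ⟨h4.1.le, h4.2.trans hs.2⟩, h3]

variable [SFinite P]

/-- The assumptions on a process under which its time integrals against integrable functions can be
computed by Fubini's theorem: continuous paths and bounded second moments. -/
structure IsL2Process (P : Measure Ω) (t : ℝ) (Y : ℝ → Ω → ℝ) : Prop where
  memLp : ∀ s ∈ Icc 0 t, MemLp (Y s) 2 P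
  continuousOn : ∀ᵐ ω ∂P, ContinuousOn (fun s => Y s ω) (Icc 0 t)
  bounded : ∃ C : ℝ, ∀ s ∈ Icc 0 t, ∫ ω, Y s ω ^ 2 ∂P ≤ C

namespace IsL2Process

omit [SFinite P] in
lemma aemeasurable (hY : IsL2Process P t Y) (s : ℝ) (hs : s ∈ Icc 0 t) : AEMeasurable (Y s) P :=
  (hY.memLp s hs).aestronglyMeasurable.aemeasurable

lemma integrable_prod (hY : IsL2Process P t Y) (hβ : IntervalIntegrable β volume 0 t) {s : ℝ}
    (hs : s ∈ Icc 0 t) {W : Ω → ℝ} (hW : MemLp W 2 P) {Z : ℝ × Ω → ℝ} (hZ : Measurable Z)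
    (hZY : ∀ r ∈ Icc 0 t, ∀ᵐ ω ∂P, Z (r, ω) = Y r ω) :
    Integrable (fun p : ℝ × Ω => β p.1 * (Z p * W p.2)) ((volume.restrict (Ioc 0 s)).prod P) ∧
    Integrable (fun p : ℝ × Ω => |β p.1| * Z p ^ 2) ((volume.restrict (Ioc 0 s)).prod P) := by
  obtain ⟨C, hC⟩ := hY.bounded
  have hβs : Integrable β (volume.restrict (Ioc 0 s)) :=
    hβ.1.mono_set (Ioc_subset_Ioc le_rfl hs.2)
  have hIoc : ∀ᵐ r ∂(volume.restrict (Ioc 0 s)), r ∈ Icc 0 t := by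
    filter_upwards [ae_restrict_mem measurableSet_Ioc] with r hr
    exact ⟨hr.1.le, hr.2.trans hs.2⟩
  have hYsq : ∀ r ∈ Icc 0 t, Integrable (fun ω => Y r ω ^ 2) P := fun r hr =>
    (hY.memLp r hr).integrable_sq
  have hm1 : AEStronglyMeasurable (fun p : ℝ × Ω => β p.1 * (Z p * W p.2))
      ((volume.restrict (Ioc 0 s)).prod P) :=
    hβs.aestronglyMeasurable.comp_fst.mul
      (hZ.aestronglyMeasurable.mul hW.aestronglyMeasurable.comp_snd)
  have hm2 : AEStronglyMeasurable (fun p : ℝ × Ω => |β p.1| * Z p ^ 2)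
      ((volume.restrict (Ioc 0 s)).prod P) :=
    hβs.abs.aestronglyMeasurable.comp_fst.mul (hZ.pow_const 2).aestronglyMeasurable
  constructor
  · rw [integrable_prod_iff hm1]
    constructor
    · filter_upwards [hIoc] with r hr
      refine (((hY.memLp r hr).integrable_mul hW).congr ?_).const_mul _
      filter_upwards [hZY r hr] with ω hω
      simp [hω]
    · refine Integrable.mono' (hβs.abs.mul_const (C + ∫ ω, W ω ^ 2 ∂P))
        hm1.norm.integral_prod_right' ?_
      filter_upwards [hIoc] with r hr
      have h1 : ∫ ω, ‖β r * (Z (r, ω) * W ω)‖ ∂P = |β r| * ∫ ω, |Y r ω * W ω| ∂P := by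
        rw [← integral_const_mul]
        refine integral_congr_ae ?_
        filter_upwards [hZY r hr] with ω hω
        simp only [hω, norm_mul, Real.norm_eq_abs, abs_mul]
      rw [h1, Real.norm_eq_abs, abs_mul, abs_abs]
      refine mul_le_mul_of_nonneg_left ?_ (abs_nonneg _)
      rw [abs_of_nonneg (integral_nonneg fun _ => abs_nonneg _)]
      calc ∫ ω, |Y r ω * W ω| ∂P ≤ ∫ ω, (Y r ω ^ 2 + W ω ^ 2) ∂P := by
            refine integral_mono ((hY.memLp r hr).integrable_mul hW).abs
              ((hYsq r hr).add hW.integrable_sq) fun ω => ?_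
            refine abs_le.2 ⟨?_, ?_⟩ <;> nlinarith [sq_nonneg (Y r ω + W ω),
              sq_nonneg (Y r ω - W ω), sq_nonneg (Y r ω), sq_nonneg (W ω)]
        _ ≤ C + ∫ ω, W ω ^ 2 ∂P := by
            rw [integral_add (hYsq r hr) hW.integrable_sq]
            linarith [hC r hr]
  · rw [integrable_prod_iff hm2]
    constructor
    · filter_upwards [hIoc] with r hr
      refine ((hYsq r hr).congr ?_).const_mul _
      filter_upwards [hZY r hr] with ω hω
      simp [hω]
    · refine Integrable.mono' (hβs.abs.mul_const C) hm2.norm.integral_prod_right' ?_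
      filter_upwards [hIoc] with r hr
      have h1 : ∫ ω, ‖|β r| * Z (r, ω) ^ 2‖ ∂P = |β r| * ∫ ω, Y r ω ^ 2 ∂P := by
        rw [← integral_const_mul]
        refine integral_congr_ae ?_
        filter_upwards [hZY r hr] with ω hω
        simp [hω]
      rw [h1, Real.norm_eq_abs, abs_mul, abs_abs,
        abs_of_nonneg (integral_nonneg fun _ => sq_nonneg _)]
      exact mul_le_mul_of_nonneg_left (hC r hr) (abs_nonneg _)

omit [SFinite P] in
lemma exists_modification (hY : IsL2Process P t Y) (ht : 0 ≤ t) :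
    ∃ Z : ℝ × Ω → ℝ, Measurable Z ∧ (∀ᵐ ω ∂P, ∀ s ∈ Icc 0 t, Z (s, ω) = Y s ω) ∧
      ∀ r ∈ Icc 0 t, ∀ᵐ ω ∂P, Z (r, ω) = Y r ω := by
  obtain ⟨Z, hZ, hZY⟩ := exists_measurable_eq_of_continuousOn ht hY.aemeasurable hY.continuousOn
  exact ⟨Z, hZ, hZY, fun r hr => hZY.mono fun ω hω => hω r hr⟩

lemma memLp_integral_mul (hY : IsL2Process P t Y) (hβ : IntervalIntegrable β volume 0 t) {s : ℝ}
    (hs : s ∈ Icc 0 t) : MemLp (fun ω => ∫ r in 0..s, β r * Y r ω) 2 P := by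
  obtain ⟨Z, hZ, hZY, hZY'⟩ := hY.exists_modification (hs.1.trans hs.2)
  have hmeas := aemeasurable_integral_mul hY.aemeasurable hY.continuousOn hβ hs
  have h2 := (hY.integrable_prod hβ hs (W := 0) MemLp.zero hZ hZY').2.integral_prod_right
  rw [memLp_two_iff_integrable_sq hmeas.aestronglyMeasurable]
  refine (h2.const_mul (∫ r in 0..s, |β r|)).mono' (hmeas.pow_const 2).aestronglyMeasurable ?_
  filter_upwards [hZY, hY.continuousOn] with ω h3 h4
  rw [Real.norm_eq_abs, abs_of_nonneg (sq_nonneg _)]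
  have hβs : IntervalIntegrable β volume 0 s := hβ.mono_set (by
    rw [uIcc_of_le hs.1, uIcc_of_le (hs.1.trans hs.2)]
    exact Icc_subset_Icc le_rfl hs.2)
  refine (sq_integral_mul_le hs.1 hβs (h4.mono (Icc_subset_Icc le_rfl hs.2))).trans_eq ?_
  congr 1
  rw [intervalIntegral.integral_of_le hs.1]
  refine setIntegral_congr_fun measurableSet_Ioc fun r hr => ?_
  simp only [h3 r ⟨hr.1.le, hr.2.trans hs.2⟩]

/-- Expectations against square integrable variables commute with time integrals. -/
lemma integral_integral_mul (hY : IsL2Process P t Y) (hβ : IntervalIntegrable β volume 0 t)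
    {s : ℝ} (hs : s ∈ Icc 0 t) {W : Ω → ℝ} (hW : MemLp W 2 P) :
    ∫ ω, (∫ r in 0..s, β r * Y r ω) * W ω ∂P = ∫ r in 0..s, β r * ∫ ω, Y r ω * W ω ∂P := by
  obtain ⟨Z, hZ, hZY, hZY'⟩ := hY.exists_modification (hs.1.trans hs.2)
  have h1 := integral_integral_swap (f := fun r ω => β r * (Z (r, ω) * W ω))
    (hY.integrable_prod hβ hs hW hZ hZY').1
  rw [intervalIntegral.integral_of_le hs.1]
  calc ∫ ω, (∫ r in 0..s, β r * Y r ω) * W ω ∂P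
      = ∫ ω, (∫ r in Ioc 0 s, β r * (Z (r, ω) * W ω)) ∂P := by
        refine integral_congr_ae ?_
        filter_upwards [hZY] with ω hω
        rw [intervalIntegral.integral_of_le hs.1, ← integral_mul_const]
        refine setIntegral_congr_fun measurableSet_Ioc fun r hr => ?_
        simp only [hω r ⟨hr.1.le, hr.2.trans hs.2⟩, mul_assoc]
    _ = ∫ r in Ioc 0 s, (∫ ω, β r * (Z (r, ω) * W ω) ∂P) := h1.symm
    _ = ∫ r in Ioc 0 s, β r * ∫ ω, Y r ω * W ω ∂P := by
        refine setIntegral_congr_fun measurableSet_Ioc fun r hr => ?_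
        simp only [integral_const_mul]
        congr 1
        refine integral_congr_ae ?_
        filter_upwards [hZY' r ⟨hr.1.le, hr.2.trans hs.2⟩] with ω hω
        rw [hω]

end IsL2Process

end TimeIntegral

/-! ### Variation of constants -/

section VariationOfConstants

variable {d e : ℕ} {t : ℝ} {A M J : ℝ → Matrix (Fin d) (Fin d) ℝ}

lemma matIntegral_mul_const {f : ℝ → Matrix (Fin d) (Fin e) ℝ} {n : ℕ} {u s : ℝ} (h : u ≤ s)
    (hf : MatIntegrableOn u s f) (K : Matrix (Fin e) (Fin n) ℝ) :
    matIntegral (fun r => f r * K) u s = matIntegral f u s * K := by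
  have h1 := (hf.matPrimitiveOn h 0).mul h (MatPrimitiveOn.const h K)
  have h2 := h1.eq_matIntegral (right_mem_Icc.2 h)
  simpa [matIntegral_self] using h2.symm

lemma const_mul_matIntegral {f : ℝ → Matrix (Fin d) (Fin e) ℝ} {n : ℕ} {u s : ℝ} (h : u ≤ s)
    (hf : MatIntegrableOn u s f) (K : Matrix (Fin n) (Fin d) ℝ) :
    matIntegral (fun r => K * f r) u s = K * matIntegral f u s := by
  have h1 := (MatPrimitiveOn.const h K).mul h (hf.matPrimitiveOn h 0)
  have h2 := h1.eq_matIntegral (right_mem_Icc.2 h)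
  simpa [matIntegral_self] using h2.symm

lemma matIntegral_transpose (f : ℝ → Matrix (Fin d) (Fin e) ℝ) (u s : ℝ) :
    (matIntegral f u s)ᵀ = matIntegral (fun r => (f r)ᵀ) u s := rfl

/-- If `y = x - ∫ A x`, then `x = y + M ∫ J A y`. -/
lemma IsFundamentalOn.matIntegral_eq (hM : IsFundamentalOn 0 t A M J) (ht : 0 ≤ t)
    (hA : MatIntegrableOn 0 t A) {x : ℝ → Matrix (Fin d) (Fin e) ℝ}
    (hx : ContinuousOn x (Icc 0 t)) {s : ℝ} (hs : s ∈ Icc 0 t) :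
    matIntegral (fun r => A r * x r) 0 s =
      M s * matIntegral
        (fun r => J r * A r * (x r - matIntegral (fun q => A q * x q) 0 r)) 0 s := by
  have h1 := hM.bwd.mul ht ((hA.mul_continuousOn ht hx).matPrimitiveOn ht 0)
  have h2 := (h1.congr (g' := fun r => J r * A r * (x r - matIntegral (fun q => A q * x q) 0 r))
    (fun _ _ => rfl) fun r _ => by
      rw [zero_add, Matrix.mul_sub, Matrix.neg_mul, Matrix.mul_assoc, Matrix.mul_assoc]
      abel).eq_matIntegral hs
  simp only [zero_add, matIntegral_self, Matrix.mul_zero] at h2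
  rw [← h2, ← Matrix.mul_assoc, hM.mul_inv s hs, Matrix.one_mul]

lemma IsFundamentalOn.add_mul_matIntegral (hM : IsFundamentalOn 0 t A M J) (ht : 0 ≤ t)
    (hA : MatIntegrableOn 0 t A) {y y' : ℝ → Matrix (Fin d) (Fin e) ℝ}
    (hy : MatPrimitiveOn 0 t y y') {s : ℝ} (hs : s ∈ Icc 0 t) :
    y s + M s * matIntegral (fun r => J r * A r * y r) 0 s =
      M s * (y 0 + matIntegral (fun r => J r * y' r) 0 s) := by
  have h1 := hM.bwd.mul ht hy
  have hJA := (hA.continuousOn_mul ht hM.bwd.continuousOn).mul_continuousOn ht hy.continuousOn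
  have h2 := ((h1.add (hJA.matPrimitiveOn ht 0)).congr (g' := fun r => J r * y' r)
    (fun _ _ => rfl) fun r _ => by
      rw [Matrix.neg_mul]
      abel).eq_matIntegral hs
  simp only [zero_add, matIntegral_self, add_zero, hM.bwd_init, Matrix.one_mul] at h2
  rw [← h2, Matrix.mul_add, ← Matrix.mul_assoc, hM.mul_inv s hs, Matrix.one_mul]

lemma MatIntegrableOn.indicator {F : ℝ → Matrix (Fin d) (Fin e) ℝ} (ht : 0 ≤ t)
    (hF : MatIntegrableOn 0 t F) (w : ℝ) : MatIntegrableOn 0 t ({r | r ≤ w}.indicator F) :=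
  fun i j => by
    have h1 : (fun r => {r | r ≤ w}.indicator F r i j) =
        {r | r ≤ w}.indicator fun r => F r i j := by
      ext r
      by_cases hr : r ≤ w <;> simp [hr]
    rw [h1, intervalIntegrable_iff_integrableOn_Ioc_of_le ht]
    exact ((intervalIntegrable_iff_integrableOn_Ioc_of_le ht).1 (hF i j)).indicator
      measurableSet_Iic

lemma matIntegral_indicator {F : ℝ → Matrix (Fin d) (Fin e) ℝ} {s w : ℝ} (hs : 0 ≤ s)
    (hw : 0 ≤ w) : matIntegral ({r | r ≤ w}.indicator F) 0 s = matIntegral F 0 (min s w) := by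
  ext i j
  have h1 : (fun r => {r | r ≤ w}.indicator F r i j) =
      {r | r ≤ w}.indicator fun r => F r i j := by
    ext r
    by_cases hr : r ≤ w <;> simp [hr]
  simp only [matIntegral, Matrix.of_apply]
  rw [h1]
  rcases le_total w s with h | h
  · rw [min_eq_right h, intervalIntegral.integral_indicator ⟨hw, h⟩]
  · rw [min_eq_left h]
    refine intervalIntegral.integral_congr fun r hr => ?_
    rw [uIcc_of_le hs] at hr
    simp [hr.2.trans h]

end VariationOfConstants

/-! ### Second moments of the linear stochastic equation -/

section LinearSDE

variable {Ω : Type*} [MeasurableSpace Ω] {P : Measure Ω} {d m : ℕ} {t : ℝ}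
  {A M J : ℝ → Matrix (Fin d) (Fin d) ℝ} {b : ℝ → Matrix (Fin d) (Fin m) ℝ}
  {V : ℝ≥0 → Ω → Fin m → ℝ} {X : ℝ → Ω → Fin d → ℝ}

/-- The driving part `X_s - ∫_0^s A(r) X_r dr` of a solution, which equals `X_0 + ∫_0^s b dV`. -/
noncomputable def sdeNoise (A : ℝ → Matrix (Fin d) (Fin d) ℝ) (X : ℝ → Ω → Fin d → ℝ) (s : ℝ)
    (ω : Ω) (i : Fin d) : ℝ :=
  X s ω i - ∑ j, ∫ r in 0..s, A r i j * X r ω j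

/-- A solution of the linear stochastic equation whose initial value is square integrable, centred
and independent of the driving Brownian motion. -/
structure IsCenteredSolution (P : Measure Ω) (A : ℝ → Matrix (Fin d) (Fin d) ℝ)
    (b : ℝ → Matrix (Fin d) (Fin m) ℝ) (V : ℝ≥0 → Ω → Fin m → ℝ) (t : ℝ)
    (X : ℝ → Ω → Fin d → ℝ) : Prop where
  nonneg : 0 ≤ t
  integrable_A : MatIntegrableOn 0 t A
  memLp_b : ∀ i l, MemLp (fun r => b r i l) 2 (volume.restrict (Icc 0 t))
  brownian : IsBrownianVec P V
  solution : IsLinearSDESolution P A b V t X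
  memLp_init : ∀ i, MemLp (fun ω => X 0 ω i) 2 P
  mean_init : ∀ i, ∫ ω, X 0 ω i ∂P = 0
  indep_init : IndepFun (X 0) (fun ω (r : ℝ≥0) => V r ω) P

namespace IsCenteredSolution

variable (h : IsCenteredSolution P A b V t X)

include h

lemma aemeasurable_apply (i : Fin d) (s : ℝ) (hs : s ∈ Icc 0 t) :
    AEMeasurable (fun ω => X s ω i) P :=
  (measurable_pi_apply i).comp_aemeasurable (h.solution.aemeasurable s hs)

lemma continuousOn_apply (i : Fin d) : ∀ᵐ ω ∂P, ContinuousOn (fun s => X s ω i) (Icc 0 t) :=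
  h.solution.continuousOn.mono fun _ hω => continuousOn_pi.1 hω i

lemma intervalIntegrable_mul {x : ℝ → ℝ} (hx : ContinuousOn x (Icc 0 t)) (i j : Fin d) {s : ℝ}
    (hs : s ∈ Icc 0 t) : IntervalIntegrable (fun r => A r i j * x r) volume 0 s := by
  refine (h.integrable_A.mono le_rfl hs.1 hs.2 i j).mul_continuousOn ?_
  rw [uIcc_of_le hs.1]
  exact hx.mono (Icc_subset_Icc le_rfl hs.2)

lemma continuousOn_sdeNoise (i : Fin d) :
    ∀ᵐ ω ∂P, ContinuousOn (fun s => sdeNoise A X s ω i) (Icc 0 t) := by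
  filter_upwards [ae_all_iff.2 h.continuousOn_apply] with ω hω
  refine (hω i).sub (continuousOn_finsetSum _ fun j _ => ?_)
  have h1 := (PrimitiveOn.integral h.nonneg (h.intervalIntegrable_mul (hω j) i j
    (right_mem_Icc.2 h.nonneg)) 0).continuousOn
  simpa only [zero_add] using h1

lemma aemeasurable_sdeNoise [SFinite P] (i : Fin d) (s : ℝ) (hs : s ∈ Icc 0 t) :
    AEMeasurable (fun ω => sdeNoise A X s ω i) P :=
  (h.aemeasurable_apply i s hs).sub (Finset.aemeasurable_fun_sum _ fun j _ =>
    aemeasurable_integral_mul (h.aemeasurable_apply j) (h.continuousOn_apply j)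
      (h.integrable_A i j) hs)

lemma isStochInt {s : ℝ} (hs : s ∈ Icc 0 t) :
    IsStochInt P V b s fun ω i => sdeNoise A X s ω i - X 0 ω i := by
  obtain ⟨f, h1, h2, h3⟩ := h.solution.equation s hs
  refine ⟨f, h1, h2, h3.congr fun n => eLpNorm_congr_ae ?_⟩
  filter_upwards [ae_all_iff.2 h.continuousOn_apply] with ω hω
  ext i
  have h4 : ∀ i, IntervalIntegrable (fun r => (A r *ᵥ X r ω) i) volume 0 s := fun i => by
    have := IntervalIntegrable.sum (a := 0) (b := s) (μ := volume) Finset.univ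
      (f := fun j r => A r i j * X r ω j) fun j _ => h.intervalIntegrable_mul (hω j) i j hs
    simp only [Finset.sum_fn] at this
    exact this
  have h5 : (∫ r in (0 : ℝ)..s, A r *ᵥ X r ω) i = ∑ j, ∫ r in 0..s, A r i j * X r ω j := by
    rw [← intervalIntegral.integral_finsetSum fun j _ => h.intervalIntegrable_mul (hω j) i j hs,
      intervalIntegral.integral_of_le hs.1, intervalIntegral.integral_of_le hs.1,
      eval_integral fun i => (h4 i).1]
    rfl
  simp only [Pi.sub_apply, h5, sdeNoise]
  ring

lemma memLp_sdeNoise [SFinite P] {s : ℝ} (hs : s ∈ Icc 0 t) (i : Fin d) :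
    MemLp (fun ω => sdeNoise A X s ω i) 2 P := by
  have h1 := (h.isStochInt hs).memLp h.brownian (i := i)
    ((h.aemeasurable_sdeNoise i s hs).sub (h.aemeasurable_apply i 0 (left_mem_Icc.2 h.nonneg)))
  refine (h1.add (h.memLp_init i)).ae_eq (Eventually.of_forall fun ω => ?_)
  simp

lemma matIntegrableOn_mul_transpose : MatIntegrableOn 0 t fun r => b r * (b r)ᵀ := fun i j => by
  refine intervalIntegrable_of_integrableOn_Icc h.nonneg ?_
  simp only [Matrix.mul_apply, Matrix.transpose_apply]
  exact integrable_finsetSum _ fun k _ => (h.memLp_b i k).integrable_mul (h.memLp_b j k)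

lemma integral_mul_noise_sub [SFinite P] {s : ℝ} (hs : s ∈ Icc 0 t) (i : Fin d) {Z : Ω → ℝ}
    (hZ : MemLp Z 2 P) (hZV : IndepFun Z (fun ω (r : ℝ≥0) => V r ω) P) :
    ∫ ω, Z ω * (sdeNoise A X s ω i - X 0 ω i) ∂P = 0 :=
  (h.isStochInt hs).integral_mul h.brownian
    ((h.aemeasurable_sdeNoise i s hs).sub (h.aemeasurable_apply i 0 (left_mem_Icc.2 h.nonneg)))
    hZ hZV

lemma integral_sdeNoise [IsProbabilityMeasure P] {s : ℝ} (hs : s ∈ Icc 0 t) (i : Fin d) :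
    ∫ ω, sdeNoise A X s ω i ∂P = 0 := by
  have h1 := h.integral_mul_noise_sub hs i (memLp_const 1) (indepFun_const_left 1 _)
  simp only [one_mul] at h1
  rwa [integral_sub ((h.memLp_sdeNoise hs i).integrable one_le_two)
    ((h.memLp_init i).integrable one_le_two), h.mean_init, sub_zero] at h1

lemma integral_sdeNoise_mul_sdeNoise [IsProbabilityMeasure P] {s w : ℝ} (hs : s ∈ Icc 0 t)
    (hw : w ∈ Icc 0 t) (i j : Fin d) :
    ∫ ω, sdeNoise A X s ω i * sdeNoise A X w ω j ∂P =
      (covMatrix P (X 0) (X 0) + matIntegral (fun r => b r * (b r)ᵀ) 0 (min s w)) i j := by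
  have h0 := left_mem_Icc.2 h.nonneg
  have hI : ∀ {s}, s ∈ Icc 0 t → ∀ i, MemLp (fun ω => sdeNoise A X s ω i - X 0 ω i) 2 P :=
    fun hs i => (h.memLp_sdeNoise hs i).sub (h.memLp_init i)
  have hm : ∀ {s}, s ∈ Icc 0 t → ∀ i, AEMeasurable (fun ω => sdeNoise A X s ω i - X 0 ω i) P :=
    fun hs i => (hI hs i).aestronglyMeasurable.aemeasurable
  have hind : ∀ i, IndepFun (fun ω => X 0 ω i) (fun ω (r : ℝ≥0) => V r ω) P := fun i =>
    h.indep_init.comp (measurable_pi_apply i) measurable_id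
  have h1 := (h.isStochInt hs).integral_mul_integral (h.isStochInt hw) h.brownian
    (hm hs i) (hm hw j)
    (fun l => (h.memLp_b i l).mono_measure
      (Measure.restrict_mono (Icc_subset_Icc le_rfl hs.2) le_rfl))
    (fun l => (h.memLp_b j l).mono_measure
      (Measure.restrict_mono (Icc_subset_Icc le_rfl hw.2) le_rfl))
  have h2 := h.integral_mul_noise_sub hw j (h.memLp_init i) (hind i)
  have h3 := h.integral_mul_noise_sub hs i (h.memLp_init j) (hind j)
  have hmin : min s w ∈ Icc 0 t := ⟨le_min hs.1 hw.1, (min_le_left _ _).trans hs.2⟩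
  have h4 : matIntegral (fun r => b r * (b r)ᵀ) 0 (min s w) i j =
      ∑ l, ∫ r in Icc 0 (min s w), b r i l * b r j l := by
    rw [matIntegral, Matrix.of_apply, intervalIntegral.integral_of_le hmin.1,
      ← integral_Icc_eq_integral_Ioc]
    simp only [Matrix.mul_apply, Matrix.transpose_apply]
    refine integral_finsetSum _ fun k _ => ?_
    have hle : volume.restrict (Icc 0 (min s w)) ≤ volume.restrict (Icc 0 t) :=
      Measure.restrict_mono (Icc_subset_Icc le_rfl hmin.2) le_rfl
    exact ((h.memLp_b i k).integrable_mul (h.memLp_b j k)).mono_measure hle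
  have h5 : covMatrix P (X 0) (X 0) i j = ∫ ω, X 0 ω i * X 0 ω j ∂P := by
    rw [covMatrix, Matrix.of_apply, covariance_eq_sub (h.memLp_init i) (h.memLp_init j),
      h.mean_init, zero_mul, sub_zero]
    rfl
  rw [Matrix.add_apply, h4, h5, ← h1]
  have h6 : ∀ ω, sdeNoise A X s ω i * sdeNoise A X w ω j =
      X 0 ω i * X 0 ω j + X 0 ω i * (sdeNoise A X w ω j - X 0 ω j) +
      X 0 ω j * (sdeNoise A X s ω i - X 0 ω i) +
      (sdeNoise A X s ω i - X 0 ω i) * (sdeNoise A X w ω j - X 0 ω j) := fun ω => by ring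
  have i1 : Integrable (fun ω => X 0 ω i * X 0 ω j) P :=
    (h.memLp_init i).integrable_mul (h.memLp_init j)
  have i2 : Integrable (fun ω => X 0 ω i * (sdeNoise A X w ω j - X 0 ω j)) P :=
    (h.memLp_init i).integrable_mul (hI hw j)
  have i3 : Integrable (fun ω => X 0 ω j * (sdeNoise A X s ω i - X 0 ω i)) P :=
    (h.memLp_init j).integrable_mul (hI hs i)
  have i4 : Integrable (fun ω =>
      (sdeNoise A X s ω i - X 0 ω i) * (sdeNoise A X w ω j - X 0 ω j)) P :=
    (hI hs i).integrable_mul (hI hw j)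
  have i12 : Integrable (fun ω => X 0 ω i * X 0 ω j +
      X 0 ω i * (sdeNoise A X w ω j - X 0 ω j)) P := i1.add i2
  have i123 : Integrable (fun ω => X 0 ω i * X 0 ω j +
      X 0 ω i * (sdeNoise A X w ω j - X 0 ω j) +
      X 0 ω j * (sdeNoise A X s ω i - X 0 ω i)) P := i12.add i3
  simp only [h6]
  rw [integral_add i123 i4, integral_add i12 i3, integral_add i1 i2, h2, h3]
  ring

lemma isL2Process_sdeNoise [IsProbabilityMeasure P] (i : Fin d) :
    IsL2Process P t fun s ω => sdeNoise A X s ω i := by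
  refine ⟨fun s hs => h.memLp_sdeNoise hs i, h.continuousOn_sdeNoise i, ?_⟩
  have h1 := (h.matIntegrableOn_mul_transpose.matPrimitiveOn h.nonneg (covMatrix P (X 0) (X 0)) i
    i).continuousOn
  obtain ⟨C, hC⟩ := isCompact_Icc.exists_bound_of_continuousOn h1
  refine ⟨C, fun s hs => ?_⟩
  have h2 := h.integral_sdeNoise_mul_sdeNoise hs hs i i
  rw [min_self] at h2
  simp only [pow_two]
  rw [h2]
  exact (le_abs_self _).trans (hC s hs)

/-- Variation of constants along paths: the solution as a functional of its driving part. -/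
lemma eq_sdeNoise_add (hM : IsFundamentalOn 0 t A M J) : ∀ᵐ ω ∂P, ∀ s ∈ Icc 0 t, ∀ i,
    X s ω i = sdeNoise A X s ω i +
      ∑ k, ∑ l, M s i k * ∫ r in 0..s, (J r * A r) k l * sdeNoise A X r ω l := by
  filter_upwards [ae_all_iff.2 h.continuousOn_apply, ae_all_iff.2 h.continuousOn_sdeNoise]
    with ω hω hω' s hs i
  let x : ℝ → Matrix (Fin d) (Fin 1) ℝ := fun r => Matrix.of fun i _ => X r ω i
  have hx : ContinuousOn x (Icc 0 t) := continuousOn_pi.2 fun i => continuousOn_pi.2 fun _ => hω i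
  have h1 := hM.matIntegral_eq h.nonneg h.integrable_A hx hs
  have hint : ∀ r ∈ Icc 0 t, ∀ i, matIntegral (fun q => A q * x q) 0 r i 0 =
      ∑ j, ∫ q in 0..r, A q i j * X q ω j := fun r hr i => by
    rw [← intervalIntegral.integral_finsetSum fun j _ => h.intervalIntegrable_mul (hω j) i j hr]
    simp only [matIntegral, Matrix.of_apply, Matrix.mul_apply, x]
  have hJA := (h.integrable_A.continuousOn_mul h.nonneg hM.bwd.continuousOn).mono le_rfl hs.1 hs.2
  have hsum : ∀ k, matIntegral
      (fun r => J r * A r * (x r - matIntegral (fun q => A q * x q) 0 r)) 0 s k 0 =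
      ∑ l, ∫ r in 0..s, (J r * A r) k l * sdeNoise A X r ω l := fun k => by
    rw [← intervalIntegral.integral_finsetSum fun l _ => (hJA k l).mul_continuousOn (by
      rw [uIcc_of_le hs.1]
      exact (hω' l).mono (Icc_subset_Icc le_rfl hs.2))]
    rw [matIntegral, Matrix.of_apply]
    refine intervalIntegral.integral_congr fun r hr => ?_
    rw [uIcc_of_le hs.1] at hr
    simp only
    rw [Matrix.mul_apply]
    refine Finset.sum_congr rfl fun l _ => ?_
    rw [Matrix.sub_apply, hint r ⟨hr.1, hr.2.trans hs.2⟩ l]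
    rfl
  have h2 := congrFun (congrFun h1 i) 0
  rw [hint s hs i, Matrix.mul_apply] at h2
  simp only [hsum, Finset.mul_sum] at h2
  rw [← h2, sdeNoise]
  ring

lemma memLp_apply [IsProbabilityMeasure P] (hM : IsFundamentalOn 0 t A M J) {s : ℝ}
    (hs : s ∈ Icc 0 t) (i : Fin d) : MemLp (fun ω => X s ω i) 2 P := by
  have hJA := h.integrable_A.continuousOn_mul h.nonneg hM.bwd.continuousOn
  have h1 : MemLp (fun ω => ∑ k, ∑ l, M s i k *
      ∫ r in 0..s, (J r * A r) k l * sdeNoise A X r ω l) 2 P :=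
    memLp_finsetSum _ fun k _ => memLp_finsetSum _ fun l _ =>
      ((h.isL2Process_sdeNoise l).memLp_integral_mul (hJA k l) hs).const_mul _
  refine ((h.memLp_sdeNoise hs i).add h1).ae_eq ?_
  filter_upwards [h.eq_sdeNoise_add hM] with ω hω
  rw [hω s hs i]
  rfl

/-- The moments of the solution against square integrable variables `W` solve the linear equation
driven by the moments `y` of its driving part. -/
lemma integral_mul_eq [IsProbabilityMeasure P] (hM : IsFundamentalOn 0 t A M J) {n : ℕ}
    {W : Ω → Fin n → ℝ} (hW : ∀ j, MemLp (fun ω => W ω j) 2 P)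
    {y y' : ℝ → Matrix (Fin d) (Fin n) ℝ} (hy : MatPrimitiveOn 0 t y y')
    (hyW : ∀ s ∈ Icc 0 t, ∀ i j, ∫ ω, sdeNoise A X s ω i * W ω j ∂P = y s i j) {s : ℝ}
    (hs : s ∈ Icc 0 t) (i : Fin d) (j : Fin n) :
    ∫ ω, X s ω i * W ω j ∂P = (M s * (y 0 + matIntegral (fun r => J r * y' r) 0 s)) i j := by
  have hJA := h.integrable_A.continuousOn_mul h.nonneg hM.bwd.continuousOn
  have hU : ∀ k l, MemLp (fun ω => ∫ r in 0..s, (J r * A r) k l * sdeNoise A X r ω l) 2 P :=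
    fun k l => (h.isL2Process_sdeNoise l).memLp_integral_mul (hJA k l) hs
  have hUW : ∀ k l, Integrable (fun ω => M s i k *
      ((∫ r in 0..s, (J r * A r) k l * sdeNoise A X r ω l) * W ω j)) P := fun k l =>
    ((hU k l).integrable_mul (hW j)).const_mul _
  have hNW : Integrable (fun ω => sdeNoise A X s ω i * W ω j) P :=
    (h.memLp_sdeNoise hs i).integrable_mul (hW j)
  have h1 : ∫ ω, X s ω i * W ω j ∂P = ∫ ω, (sdeNoise A X s ω i * W ω j + ∑ k, ∑ l, M s i k *
      ((∫ r in 0..s, (J r * A r) k l * sdeNoise A X r ω l) * W ω j)) ∂P := by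
    refine integral_congr_ae ?_
    filter_upwards [h.eq_sdeNoise_add hM] with ω hω
    rw [hω s hs i, add_mul, Finset.sum_mul]
    simp only [Finset.sum_mul, mul_assoc]
  have h2 : ∀ k l, ∫ ω, (∫ r in 0..s, (J r * A r) k l * sdeNoise A X r ω l) * W ω j ∂P =
      ∫ r in 0..s, (J r * A r) k l * y r l j := fun k l => by
    rw [(h.isL2Process_sdeNoise l).integral_integral_mul (hJA k l) hs (hW j)]
    refine intervalIntegral.integral_congr fun r hr => ?_
    rw [uIcc_of_le hs.1] at hr
    simp only [hyW r ⟨hr.1, hr.2.trans hs.2⟩ l j]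
  rw [h1, integral_add hNW (integrable_finsetSum _ fun k _ => integrable_finsetSum _ fun l _ =>
    hUW k l), integral_finsetSum _ fun k _ => integrable_finsetSum _ fun l _ => hUW k l,
    hyW s hs i j, ← hM.add_mul_matIntegral h.nonneg h.integrable_A hy hs, Matrix.add_apply,
    Matrix.mul_apply]
  congr 1
  refine Finset.sum_congr rfl fun k _ => ?_
  rw [integral_finsetSum _ fun l _ => hUW k l]
  simp only [integral_const_mul, h2, ← Finset.mul_sum]
  congr 1
  rw [← intervalIntegral.integral_finsetSum fun l _ =>
    ((hJA k l).mul_continuousOn (by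
      rw [uIcc_of_le h.nonneg]
      exact (hy l j).continuousOn)).mono_set (by
        rw [uIcc_of_le h.nonneg, uIcc_of_le hs.1]
        exact Icc_subset_Icc le_rfl hs.2)]
  simp only [matIntegral, Matrix.of_apply, Matrix.mul_apply (M := J _ * A _)]

lemma integral_apply [IsProbabilityMeasure P] (hM : IsFundamentalOn 0 t A M J) {s : ℝ}
    (hs : s ∈ Icc 0 t) (i : Fin d) : ∫ ω, X s ω i ∂P = 0 := by
  have h1 := h.integral_mul_eq hM (n := 1) (W := fun _ _ => 1) (fun _ => memLp_const 1)
    (MatPrimitiveOn.const h.nonneg 0) (fun s hs i j => by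
      simp only [mul_one, Matrix.zero_apply, h.integral_sdeNoise hs i]) hs i 0
  have h2 : matIntegral (fun r => J r * (fun _ => 0 : ℝ → Matrix (Fin d) (Fin 1) ℝ) r) 0 s = 0 := by
    ext i j
    simp [matIntegral]
  rw [h2, add_zero, Matrix.mul_zero] at h1
  simp only [mul_one] at h1
  exact h1

/-- The covariance function of the solution, with `Σ(u) = Cov(X_0) + ∫_0^u J b bᵀ Jᵀ`, is
`Cov(X_s, X_u) = M(s) Σ(u) M(u)ᵀ` for `u ≤ s`. -/
lemma covMatrix_eq [IsProbabilityMeasure P] (hM : IsFundamentalOn 0 t A M J) {u s : ℝ}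
    (hu : 0 ≤ u) (hus : u ≤ s) (hst : s ≤ t) :
    covMatrix P (X s) (X u) = M s * (covMatrix P (X 0) (X 0) +
      matIntegral (fun r => J r * (b r * (b r)ᵀ) * (J r)ᵀ) 0 u) * (M u)ᵀ := by
  have hs' : s ∈ Icc 0 t := ⟨hu.trans hus, hst⟩
  have hu' : u ∈ Icc 0 t := ⟨hu, hus.trans hst⟩
  set S := covMatrix P (X 0) (X 0) with hS
  have hSt : Sᵀ = S := by
    ext i j
    simp only [hS, covMatrix, Matrix.transpose_apply, Matrix.of_apply]
    exact covariance_comm _ _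
  have hB := h.matIntegrableOn_mul_transpose
  have hJc := hM.bwd.continuousOn
  have hJtc := continuous_id.matrix_transpose.comp_continuousOn hJc
  have hind : ∀ {F : ℝ → Matrix (Fin d) (Fin d) ℝ} {w r : ℝ}, J r * {r | r ≤ w}.indicator F r =
      {r | r ≤ w}.indicator (fun r => J r * F r) r := fun {F w r} => by
    by_cases hr : r ≤ w <;> simp [hr]
  -- The moments of the solution against its driving part.
  have key1 : ∀ w ∈ Icc 0 t, ∀ s ∈ Icc 0 t, ∀ i j, ∫ ω, X s ω i * sdeNoise A X w ω j ∂P =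
      (M s * (S + matIntegral (fun r => J r * (b r * (b r)ᵀ)) 0 (min s w))) i j := by
    intro w hw s hs i j
    have h1 := h.integral_mul_eq hM (W := sdeNoise A X w) (fun j => h.memLp_sdeNoise hw j)
      ((hB.indicator h.nonneg w).matPrimitiveOn h.nonneg S) (fun s hs i j => by
        rw [matIntegral_indicator hs.1 hw.1]
        exact h.integral_sdeNoise_mul_sdeNoise hs hw i j) hs i j
    rw [h1]
    simp only [hind, matIntegral_self, add_zero]
    rw [matIntegral_indicator hs.1 hw.1]
  -- The moments of the driving part against `X_u`, as a function of the time of the driving part.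
  have hBJ : MatIntegrableOn 0 t fun r => (b r * (b r)ᵀ) * (J r)ᵀ :=
    hB.mul_continuousOn h.nonneg hJtc
  have hy := ((hBJ.indicator h.nonneg u).matPrimitiveOn h.nonneg S).mul h.nonneg
    (MatPrimitiveOn.const h.nonneg (M u)ᵀ)
  have key2 : ∀ i j, ∫ ω, X s ω i * X u ω j ∂P = (M s * (S +
      matIntegral (fun r => J r * (b r * (b r)ᵀ) * (J r)ᵀ) 0 u) * (M u)ᵀ) i j := by
    intro i j
    have h1 := h.integral_mul_eq hM (W := X u) (fun j => h.memLp_apply hM hu' j) hy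
      (fun r hr i j => by
        simp only [mul_comm (sdeNoise A X r _ i)]
        rw [key1 r hr u hu' j i, matIntegral_indicator hr.1 hu, min_comm r u]
        have h2 : (matIntegral (fun r => J r * (b r * (b r)ᵀ)) 0 (min u r))ᵀ =
            matIntegral (fun r => (b r * (b r)ᵀ) * (J r)ᵀ) 0 (min u r) := by
          rw [matIntegral_transpose]
          simp only [Matrix.transpose_mul, Matrix.transpose_transpose]
        have h3 := congrFun (congrFun (Matrix.transpose_mul (M u)
          (S + matIntegral (fun r => J r * (b r * (b r)ᵀ)) 0 (min u r))) i) j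
        rwa [Matrix.transpose_add, hSt, h2] at h3) hs' i j
    rw [h1]
    have h2 : ∀ r, J r * ({r | r ≤ u}.indicator (fun r => (b r * (b r)ᵀ) * (J r)ᵀ) r * (M u)ᵀ +
        (S + matIntegral ({r | r ≤ u}.indicator fun r => (b r * (b r)ᵀ) * (J r)ᵀ) 0 r) * 0) =
        {r | r ≤ u}.indicator (fun r => J r * (b r * (b r)ᵀ) * (J r)ᵀ) r * (M u)ᵀ := fun r => by
      rw [mul_zero, add_zero, ← mul_assoc, hind]
      simp only [mul_assoc]
    simp only [h2, matIntegral_self, add_zero]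
    have h3 : MatIntegrableOn 0 t fun r => J r * (b r * (b r)ᵀ) * (J r)ᵀ :=
      (hB.continuousOn_mul h.nonneg hJc).mul_continuousOn h.nonneg hJtc
    rw [matIntegral_mul_const hs'.1 ((h3.indicator h.nonneg u).mono le_rfl hs'.1 hst),
      matIntegral_indicator hs'.1 hu, min_eq_right hus, ← add_mul, mul_assoc]
  ext i j
  rw [covMatrix, Matrix.of_apply, covariance_eq_sub (h.memLp_apply hM hs' i)
    (h.memLp_apply hM hu' j), h.integral_apply hM hs', zero_mul, sub_zero, ← key2 i j]
  rfl

end IsCenteredSolution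

end LinearSDE

/-! ### The covariance function of the smoothing process -/

section Smoothing

variable {d₁ d₂ m₁ m₂ : ℕ} {a : ℝ → Matrix (Fin d₁) (Fin d₁) ℝ}
  {b : ℝ → Matrix (Fin d₁) (Fin m₁) ℝ} {c : ℝ → Matrix (Fin d₂) (Fin d₁) ℝ}
  {σ : ℝ → Matrix (Fin d₂) (Fin m₂) ℝ} {γ φ : ℝ → Matrix (Fin d₁) (Fin d₁) ℝ} {t : ℝ}

lemma IsForwardRiccati.init {S₀ : Matrix (Fin d₁) (Fin d₁) ℝ}
    (hγ : IsForwardRiccati a b c σ S₀ γ) : γ 0 = S₀ := by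
  rw [hγ.equation 0 le_rfl, matIntegral_self, add_zero]

lemma riccatiPair (hcoef : CoefficientAssumptions a b c σ) {S₀ : Matrix (Fin d₁) (Fin d₁) ℝ}
    (hγ : IsForwardRiccati a b c σ S₀ γ) (ht : 0 ≤ t) (hφ : IsBackwardRiccati a b c σ t φ) :
    RiccatiPair t a (fun r => b r * (b r)ᵀ) (obsInfo c σ) γ φ := by
  have ha := hcoef.matIntegrableOn_a ht
  have hB := hcoef.matIntegrableOn_mul_transpose_b ht
  have hG := hcoef.matIntegrableOn_obsInfo ht
  have hγc : ContinuousOn γ (Icc 0 t) := hγ.continuousOn.mono Icc_subset_Ici_self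
  have hφc := hφ.continuousOn
  constructor
  · exact ht
  · refine (MatIntegrableOn.matPrimitiveOn ht ?_ S₀).congr (fun s hs => hγ.equation s hs.1)
      fun _ _ => rfl
    exact ((((hG.continuousOn_mul ht hγc).mul_continuousOn ht hγc).neg.add
      (ha.mul_continuousOn ht hγc)).add (ha.transpose.continuousOn_mul ht hγc)).add hB
  · have hF : MatIntegrableOn 0 t fun r => -(φ r * (b r * (b r)ᵀ) * φ r) - (a r)ᵀ * φ r -
        φ r * a r + obsInfo c σ r :=
      ((((hB.continuousOn_mul ht hφc).mul_continuousOn ht hφc).neg.sub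
        (ha.transpose.mul_continuousOn ht hφc)).sub (ha.continuousOn_mul ht hφc)).add hG
    exact (hF.matPrimitiveOn_left ht).neg.congr (fun s hs => hφ.equation s hs)
      fun _ _ => (neg_neg _).symm
  · rw [hφ.equation t (right_mem_Icc.2 ht), matIntegral_self, neg_zero]
  · exact hG
  · exact fun s _ => by simp
  · exact fun s _ => obsInfo_transpose s
  · exact fun s hs => by simpa using (hγ.posSemidef s hs.1).isHermitian.eq
  · exact fun s hs => by simpa using (hφ.negSemidef s hs).isHermitian.eq

lemma IsSmoothingProcess.isCenteredSolution {Ω : Type*} [MeasurableSpace Ω] {P : Measure Ω}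
    {S₀ : Matrix (Fin d₁) (Fin d₁) ℝ} {V : ℝ≥0 → Ω → Fin m₁ → ℝ} {ξ : ℝ → Ω → Fin d₁ → ℝ}
    (hξ : IsSmoothingProcess P a b S₀ φ V t ξ) (hcoef : CoefficientAssumptions a b c σ)
    (ht : 0 ≤ t) (hφ : ContinuousOn φ (Icc 0 t)) :
    IsCenteredSolution P (fun s => a s + b s * (b s)ᵀ * φ s) b V t ξ where
  nonneg := ht
  integrable_A := (hcoef.matIntegrableOn_a ht).add
    ((hcoef.matIntegrableOn_mul_transpose_b ht).mul_continuousOn ht hφ)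
  memLp_b := hcoef.memLp_b t ht
  brownian := hξ.brownian
  solution := hξ.solution
  memLp_init i := (hξ.gaussian_init.eval i).memLp_two
  mean_init i := by
    have h := congrFun hξ.mean_init i
    rwa [eval_integral fun i => (hξ.gaussian_init.eval i).integrable] at h
  indep_init := hξ.indep_init

/-- The integral in the covariance formula is `N(s)` composed with the filter transition. -/
lemma IsFundamentalOn.matIntegral_orderedExp {d : ℕ} {F G Ψ Θ : ℝ → Matrix (Fin d) (Fin d) ℝ}
    (hΨ : IsFundamentalOn 0 t F Ψ Θ) (hF : MatIntegrableOn 0 t F) (hG : MatIntegrableOn 0 t G)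
    {u s : ℝ} (hu : 0 ≤ u) (hus : u ≤ s) (hst : s ≤ t) :
    MatIntegrableOn s t (fun v => (orderedExp F s v)ᵀ * G v * orderedExp F u v) ∧
    matIntegral (fun v => (orderedExp F s v)ᵀ * G v * orderedExp F u v) s t =
      gramian t G Ψ Θ s * orderedExp F u s := by
  have hs := hu.trans hus
  have ht := hs.trans hst
  have hΨc := hΨ.fwd.continuousOn
  have hΨt := continuous_id.matrix_transpose.comp_continuousOn hΨc
  have hR : MatIntegrableOn s t fun v => (Ψ v)ᵀ * G v * Ψ v :=
    ((hG.continuousOn_mul ht hΨt).mul_continuousOn ht hΨc).mono hs hst le_rfl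
  have hL : MatIntegrableOn s t fun v => (Θ s)ᵀ * ((Ψ v)ᵀ * G v * Ψ v) :=
    hR.continuousOn_mul hst continuousOn_const
  have hLR : MatIntegrableOn s t fun v => (Θ s)ᵀ * ((Ψ v)ᵀ * G v * Ψ v) * Θ u :=
    hL.mul_continuousOn hst continuousOn_const
  have heq : ∀ v ∈ Icc s t, (orderedExp F s v)ᵀ * G v * orderedExp F u v =
      (Θ s)ᵀ * ((Ψ v)ᵀ * G v * Ψ v) * Θ u := fun v hv => by
    rw [hΨ.orderedExp_eq hF hs hv.1 hv.2, hΨ.orderedExp_eq hF hu (hus.trans hv.1) hv.2,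
      Matrix.transpose_mul]
    noncomm_ring
  have hP := (hLR.matPrimitiveOn hst 0).congr (fun _ _ => rfl) heq
  refine ⟨hP.integrable, ?_⟩
  have h1 := hP.eq_matIntegral (right_mem_Icc.2 hst)
  rw [matIntegral_self, zero_add, add_zero, zero_add, matIntegral_mul_const hst hL,
    const_mul_matIntegral hst hR] at h1
  rw [← h1, hΨ.orderedExp_eq hF hu hus hst, gramian]
  calc _ = (Θ s)ᵀ * matIntegral (fun v => (Ψ v)ᵀ * G v * Ψ v) s t * (Θ s * Ψ s) * Θ u := by
        rw [hΨ.inv_mul s ⟨hs, hst⟩, mul_one]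
    _ = _ := by noncomm_ring

end Smoothing

end LinearSmoothing

theorem mainTheorem10 {Ω : Type*} [MeasurableSpace Ω] (P : Measure Ω) [IsProbabilityMeasure P]
    {d₁ d₂ m₁ m₂ : ℕ}
    (a : ℝ → Matrix (Fin d₁) (Fin d₁) ℝ) (b : ℝ → Matrix (Fin d₁) (Fin m₁) ℝ)
    (c : ℝ → Matrix (Fin d₂) (Fin d₁) ℝ) (σ : ℝ → Matrix (Fin d₂) (Fin m₂) ℝ)
    (hcoef : LinearSmoothing.CoefficientAssumptions a b c σ)
    (X₀ : Ω → Fin d₁ → ℝ) (hX₀ : HasGaussianLaw X₀ P)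
    (γ : ℝ → Matrix (Fin d₁) (Fin d₁) ℝ)
    (hγ : LinearSmoothing.IsForwardRiccati a b c σ (LinearSmoothing.covMatrix P X₀ X₀) γ)
    (t : ℝ) (ht : 0 ≤ t)
    (φ : ℝ → Matrix (Fin d₁) (Fin d₁) ℝ)
    (hφ : LinearSmoothing.IsBackwardRiccati a b c σ t φ)
    (V : ℝ≥0 → Ω → Fin m₁ → ℝ) (ξ : ℝ → Ω → Fin d₁ → ℝ)
    (hξ : LinearSmoothing.IsSmoothingProcess P a b (LinearSmoothing.covMatrix P X₀ X₀) φ V t ξ) :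
    let G : ℝ → Matrix (Fin d₁) (Fin d₁) ℝ := LinearSmoothing.obsInfo c σ
    -- `Ψ u s` is the filter transition, the time-ordered exponential of `∫_u^s (a - γ G)`
    let Ψ : ℝ → ℝ → Matrix (Fin d₁) (Fin d₁) ℝ :=
      LinearSmoothing.orderedExp (fun r => a r - γ r * G r)
    (∀ s ∈ Icc 0 t, MemLp (ξ s) 2 P) ∧
    ∀ u s : ℝ, 0 ≤ u → u ≤ s → s ≤ t →
      (∀ i j, IntervalIntegrable (fun v => ((Ψ s v)ᵀ * G v * Ψ u v) i j) volume s t) ∧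
      LinearSmoothing.covMatrix P (ξ s) (ξ u) =
        Ψ u s * γ u -
          γ s * LinearSmoothing.matIntegral (fun v => (Ψ s v)ᵀ * G v * Ψ u v) s t * γ u := by
  intro G Ψ
  have hR := LinearSmoothing.riccatiPair hcoef hγ ht hφ
  have hX := hξ.isCenteredSolution hcoef ht hφ.continuousOn
  have hγc : ContinuousOn γ (Icc 0 t) := hγ.continuousOn.mono Icc_subset_Ici_self
  have hF : LinearSmoothing.MatIntegrableOn 0 t fun r => a r - γ r * G r :=
    (hcoef.matIntegrableOn_a ht).sub (hR.integrable_G.continuousOn_mul ht hγc)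
  obtain ⟨Θ, hΨ⟩ := LinearSmoothing.exists_isFundamentalOn ht hF
  obtain ⟨J, hM⟩ := LinearSmoothing.exists_isFundamentalOn ht hX.integrable_A
  refine ⟨fun s hs => MemLp.of_eval fun i => hX.memLp_apply hM hs i, fun u s hu hus hst => ?_⟩
  obtain ⟨hint, heq⟩ := hΨ.matIntegral_orderedExp hF hR.integrable_G hu hus hst
  refine ⟨hint, ?_⟩
  have h0 := left_mem_Icc.2 ht
  have hu' : u ∈ Icc 0 t := ⟨hu, hus.trans hst⟩
  have hinit := LinearSmoothing.sqrt_mul_inv_mul_sqrt (hγ.posSemidef 0 le_rfl)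
    (hR.one_sub_mul_one_sub hΨ hM h0)
  have hconj := (hR.matPrimitiveOn_conj hΨ hM).eq_matIntegral hu'
  -- At time zero `(1 - γ N) γ` is the prescribed covariance matrix of the initial value.
  rw [hM.bwd_init, one_mul, Matrix.transpose_one, mul_one, ← hinit, hγ.init, ← hξ.cov_init] at hconj
  have hJM : (J u)ᵀ *
      (LinearSmoothing.orderedExp (fun s => a s + b s * (b s)ᵀ * φ s) 0 u)ᵀ = 1 := by
    rw [← Matrix.transpose_mul, hM.mul_inv u hu', Matrix.transpose_one]
  have htrans := hR.transition_eq hΨ hM hu hus hst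
  rw [hX.covMatrix_eq hM hu hus hst, ← hconj, heq]
  rw [← hΨ.orderedExp_eq hF hu hus hst] at htrans
  rw [← mul_assoc, mul_assoc _ _ (_)ᵀ, hJM, mul_one, ← mul_assoc, ← mul_assoc, htrans,
    Matrix.sub_mul, Matrix.sub_mul, Matrix.one_mul, ← Matrix.mul_assoc]
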